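/- Let $k\ge 3$ be an integer and let $\mathcal{G}_k$ be the class of all finite simple $2k$-regular graphs of girth at least $2k-2$ that admit a pair of (edge-)disjoint perfect matchings. The length of a graph is its number of edges, and a decomposition of a graph $G$ is a set of subgraphs of $G$ whose edge sets partition $E(G)$. A $k$-balanced decomposition of $G$ is a decomposition $\mathcal{D}$ of $G$ into paths and cycles, all of whose lengths lie in $\{2k-1,2k,2k+1\}$, such that (a) for every vertex $v$ of $G$, the number of paths in $\mathcal{D}$ of length at most $2k$ with end vertex $v$ is at least the number of paths in $\mathcal{D}$ of length at least $2k+1$ with end vertex $v$; and (b) the number of paths of length $2k-1$ in $\mathcal{D}$ equals the number of paths of length $2k+1$ in $\mathcal{D}$. Theorem. Every graph in $\mathcal{G}_k$ has a $k$-balanced decomposition in which every cycle has length $2k$. -/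

import Mathlib

namespace PathCycleDecomposition

variable {V : Type*} {G : SimpleGraph V}

/-- The class `𝒢_k` (for an integer `k ≥ 3`): `2k`-regular graphs of girth at least `2k - 2` that
admit a pair of disjoint perfect matchings. -/
structure InClass (k : ℕ) (G : SimpleGraph V) [G.LocallyFinite] : Prop where
  regular : G.IsRegularOfDegree (2 * k)
  girth : ((2 * k - 2 : ℕ) : ℕ∞) ≤ G.egirth
  matchings : ∃ M₁ M₂ : G.Subgraph, M₁.IsPerfectMatching ∧ M₂.IsPerfectMatching ∧
    Disjoint M₁.edgeSet M₂.edgeSet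

/-- The length of a graph is its number of edges. -/
noncomputable def length (H : G.Subgraph) : ℕ := H.edgeSet.ncard

/-- The subgraph `H` is a path and `v` is one of its end vertices. -/
def IsPathWithEnd (H : G.Subgraph) (v : V) : Prop :=
  ∃ (w : V) (p : G.Walk v w), p.IsPath ∧ p.toSubgraph = H

/-- The subgraph `H` is a path. -/
def IsPathGraph (H : G.Subgraph) : Prop := ∃ v, IsPathWithEnd H v

/-- The subgraph `H` is a cycle. -/
def IsCycleGraph (H : G.Subgraph) : Prop :=
  ∃ (v : V) (c : G.Walk v v), c.IsCycle ∧ c.toSubgraph = H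

/-- A decomposition of `G`: a set of subgraphs that partition the edge set of `G`. -/
structure IsDecomposition (D : Set G.Subgraph) : Prop where
  nonempty : ∀ H ∈ D, H.edgeSet.Nonempty
  disjoint : D.PairwiseDisjoint SimpleGraph.Subgraph.edgeSet
  cover : ⋃ H ∈ D, H.edgeSet = G.edgeSet

/-- An `N`-decomposition: a decomposition into paths and cycles, all with lengths in `N`. -/
structure IsLengthDecomposition (N : Set ℕ) (D : Set G.Subgraph) : Prop where
  decomposition : IsDecomposition D
  path_or_cycle : ∀ H ∈ D, IsPathGraph H ∨ IsCycleGraph H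
  length_mem : ∀ H ∈ D, length H ∈ N

/-- `D` is `k`-balanced at `v`: at least as many paths of length at most `2k` as paths of length
at least `2k + 1` have end vertex `v`. -/
def IsBalancedAt (k : ℕ) (D : Set G.Subgraph) (v : V) : Prop :=
  {H ∈ D | IsPathWithEnd H v ∧ 2 * k + 1 ≤ length H}.ncard ≤
    {H ∈ D | IsPathWithEnd H v ∧ length H ≤ 2 * k}.ncard

/-- A `k`-balanced decomposition (for `k ≥ 3`) of a finite graph. -/
structure IsBalancedDecomposition (k : ℕ) (D : Set G.Subgraph) : Prop where
  lengths : IsLengthDecomposition {2 * k - 1, 2 * k, 2 * k + 1} D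
  balanced : ∀ v : V, IsBalancedAt k D v
  equal_count : {H ∈ D | IsPathGraph H ∧ length H = 2 * k - 1}.ncard =
    {H ∈ D | IsPathGraph H ∧ length H = 2 * k + 1}.ncard

end PathCycleDecomposition

/-!
Let `m` and `ν` be the fixed-point-free involutions given by two disjoint perfect matchings of the
`2 * k`-regular graph `G`. The decomposition is built in two steps: `G` minus the matching `ν` is
decomposed into paths with `2 * k - 1` edges, and then the edges of `ν` are attached to the ends of
these paths. Throughout, a trail is a list of vertices that is kept in both of its directions, so
that the trails are indexed by their starting ends; the involution `μ` exchanges the two ends. Only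
the fact that the trails cover all edges is checked by hand. By `consec_unique`, a family of lists
that covers all darts and has no more positions than there are darts covers each dart exactly once.

*Paths* (`nonempty_pathSystem`). By Petersen's theorem, `G` without both matchings is a union of
`k - 1` two-factors, which are oriented as permutations. The edges of `m` are extended at both ends
along each of the first `k - 3` of them, and by two vertices at each end along the last two, `α` and
`β`. Since the girth is at least `2 * k - 2`, a repeated vertex in a trail with `2 * k` vertices
must be its end, repeated at the other end or next to it. The first repetition is excluded because
each vertex is the beginning of one trail, the second one can happen only at *bad* vertices, where
`β (α u) = α (μ u)`. There the trail is extended by three vertices at one end and by one at the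
other. The vertices where this is done form a kernel of the bad set under `u ↦ μ (α u)`, which
exists unless a cycle of length at least three of this permutation is bad; and no cycle is, if the
splitting into `α` and `β` is chosen extremal (`exists_splitting_kernel`).

*Matching* (`PathSystem.nonempty_trailSystem`). The edge of `ν` at `w` can be attached to the path
with end `w` unless `ν w` is an inner vertex of that path, and to the path with end `ν w` likewise.
If both fail, then by the girth `ν w` is close to the far end of the path of `w`, and this path is
rotated: it takes up the edge from `w` to `ν w` and releases the edge from `P.z w` to `ν w`, which
by the girth can be attached to the path with end `ν w`. Rotations can interfere with each other and
with other extensions of the same path; `Selection.Extends` lists the rules that avoid this, and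
`Selection.Extends.notMem_or` and `Selection.Extends.not_μ` show that they give only paths, and
cycles with `2 * k` edges.

*Balance* (`TrailSystem.isBalancedDecomposition`). Each extension that arrives at a vertex `v` is
made up for by an unextended end at `v` (`Selection.exists_injOn_extends`). This gives the
inequality at `v`, and it bounds the number of extended ends by that of unextended ones, which is
the bound on the number of positions that the counting needs. As the number of edges forces
equality, there are as many trails with two extensions as with none.
-/

namespace PathCycleDecomposition

/-! ### Involutions, kernels and two-factorizations -/

section

/-- Two involutions without fixed points have a common transversal. The involution
`a` maps no orbit of `a ∘ b` to itself: it reverses the cyclic order, so otherwise `a` or `b` would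
have a fixed point there. The transversal contains one orbit of each pair that `a` exchanges. -/
theorem exists_common_transversal {X : Type*} (a b : X → X) (ha : ∀ x, a (a x) = x)
    (hb : ∀ x, b (b x) = x) (ha' : ∀ x, a x ≠ x) (hb' : ∀ x, b x ≠ x) :
    ∃ S : Set X, ∀ x, (a x ∈ S ↔ x ∉ S) ∧ (b x ∈ S ↔ x ∉ S) := by
  classical
  let A : Equiv.Perm X := Function.Involutive.toPerm a ha
  let B : Equiv.Perm X := Function.Involutive.toPerm b hb
  let p : Equiv.Perm X := A * B
  have hA : ∀ x, A x = a x := fun _ => rfl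
  have hpx : ∀ x, p x = a (b x) := fun _ => rfl
  have hApA : A * p * A⁻¹ = p⁻¹ := by
    ext x
    have hAi : A⁻¹ x = a x := rfl
    have hpi : p⁻¹ x = b (a x) := by
      rw [Equiv.Perm.inv_eq_iff_eq, hpx, hb, ha]
    rw [hpi]
    change A (p (A⁻¹ x)) = _
    rw [hAi, hA, hpx, ha]
  have hcomm : ∀ (n : ℤ) x, a ((p ^ n) x) = (p ^ (-n)) (a x) := by
    intro n x
    have : A * p ^ n * A⁻¹ = p ^ (-n) := by
      rw [← conj_zpow, hApA, inv_zpow']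
    rw [← this]
    change _ = a ((p ^ n) (a (a x)))
    rw [ha]
  have hadd : ∀ (m n : ℤ) x, (p ^ m) ((p ^ n) x) = (p ^ (m + n)) x := by
    intro m n x
    rw [zpow_add, Equiv.Perm.mul_apply]
  -- `a` maps no orbit of `p` to itself
  have key : ∀ (n : ℤ) x, (p ^ n) x ≠ a x := by
    intro n x h
    rcases Int.even_or_odd' n with ⟨j, rfl | rfl⟩
    · apply ha' ((p ^ j) x)
      rw [hcomm, ← h, hadd]
      congr 2
      ring
    · apply hb' ((p ^ j) x)
      have h1 : a ((p ^ j) x) = p ((p ^ j) x) := by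
        have h2 : p ((p ^ j) x) = (p ^ (1 + j)) x := by rw [← hadd, zpow_one]
        rw [hcomm, ← h, hadd, h2]
        congr 2
        ring
      rw [hpx] at h1
      have := congrArg a h1
      rw [ha, ha] at this
      exact this.symm
  let r : Setoid X :=
    { r := fun x y => ∃ n : ℤ, y = (p ^ n) x ∨ y = (p ^ n) (a x)
      iseqv := by
        refine ⟨fun x => ⟨0, Or.inl (by simp)⟩, ?_, ?_⟩
        · rintro x y ⟨n, rfl | rfl⟩
          · exact ⟨-n, Or.inl (by rw [hadd]; simp)⟩
          · refine ⟨n, Or.inr ?_⟩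
            rw [hcomm, ha, hadd]
            simp
        · rintro x y z ⟨n, rfl | rfl⟩ ⟨m, rfl | rfl⟩
          · exact ⟨m + n, Or.inl (hadd _ _ _)⟩
          · exact ⟨m + -n, Or.inr (by rw [hcomm, hadd])⟩
          · exact ⟨m + n, Or.inr (hadd _ _ _)⟩
          · exact ⟨m + -n, Or.inl (by rw [hcomm, ha, hadd])⟩ }
  let q : X → X := fun x => (Quotient.mk r x).out
  have hq : ∀ x, ∃ n : ℤ, x = (p ^ n) (q x) ∨ x = (p ^ n) (a (q x)) := fun x =>
    Quotient.mk_out (s := r) x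
  have hqc : ∀ x y, (∃ n : ℤ, y = (p ^ n) x ∨ y = (p ^ n) (a x)) → q x = q y := by
    intro x y h
    have : Quotient.mk r x = Quotient.mk r y := Quotient.sound h
    simp only [q, this]
  have hqa : ∀ x, q (a x) = q x := fun x => (hqc x (a x) ⟨0, Or.inr (by simp)⟩).symm
  have hqp : ∀ x, q (p x) = q x := fun x => (hqc x (p x) ⟨1, Or.inl (by simp)⟩).symm
  let S : Set X := {x | ∃ n : ℤ, x = (p ^ n) (q x)}
  have hSa : ∀ x, a x ∈ S ↔ x ∉ S := by
    intro x
    constructor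
    · rintro ⟨n, hn⟩ ⟨m, hm⟩
      rw [hqa] at hn
      have h1 : a x = (p ^ (-m)) (a (q x)) := by
        conv_lhs => rw [hm]
        exact hcomm _ _
      apply key (m + n) (q x)
      rw [← hadd, ← hn, h1, hadd]
      simp
    · intro hx
      obtain ⟨n, hn | hn⟩ := hq x
      · exact absurd ⟨n, hn⟩ hx
      · refine ⟨-n, ?_⟩
        rw [hqa]
        conv_lhs => rw [hn]
        rw [hcomm, ha]
  have hSp : ∀ x, p x ∈ S ↔ x ∈ S := by
    intro x
    constructor
    · rintro ⟨n, hn⟩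
      rw [hqp] at hn
      refine ⟨-1 + n, ?_⟩
      rw [← hadd, ← hn]
      simp
    · rintro ⟨n, hn⟩
      refine ⟨1 + n, ?_⟩
      rw [hqp, ← hadd, ← hn]
      simp
  refine ⟨S, fun x => ⟨hSa x, ?_⟩⟩
  have : b x = a (p x) := by rw [hpx, ha]
  rw [this, hSa, hSp]

/-- A kernel of the functional digraph that `σ` induces on `Y`, which exists because no directed
cycle of this digraph is longer than two: a vertex whose successor lies outside `Y`, or one vertex
of a cycle of length two, is put into the kernel and removed together with its predecessor. -/
theorem exists_kernel {V : Type*} [DecidableEq V] (σ : Equiv.Perm V) (Y : Finset V)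
    (h2 : ∀ u ∈ Y, (∀ n : ℕ, σ^[n] u ∈ Y) → σ (σ u) = u) (h1 : ∀ u ∈ Y, σ u ≠ u) :
    ∃ S ⊆ Y, (∀ u ∈ S, σ u ∉ S) ∧ ∀ u ∈ Y, u ∉ S → σ u ∈ S := by
  induction Y using Finset.strongInduction with
  | H Y ih =>
    rcases Y.eq_empty_or_nonempty with rfl | ⟨u0, hu0⟩
    · exact ⟨∅, by simp⟩
    by_cases hc : ∃ u ∈ Y, σ u ∉ Y
    · obtain ⟨u, hu, hsu⟩ := hc
      obtain ⟨S, hS, hS1, hS2⟩ := ih ((Y.erase u).erase (σ.symm u))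
        ((Finset.erase_subset _ _).trans_ssubset (Finset.erase_ssubset hu))
        (fun x hx hn => h2 x (by grind) (fun n => by have := hn n; grind))
        (fun x hx => h1 x (by grind))
      refine ⟨insert u S, by grind, ?_, ?_⟩
      · intro x hx hsx
        have hx' : x = u ∨ x ∈ S := by simpa using hx
        rcases hx' with rfl | hx
        · have : σ x ∈ S := by
            rcases Finset.mem_insert.1 hsx with h | h
            · exact absurd h (h1 x hu)
            · exact h
          grind
        · rcases Finset.mem_insert.1 hsx with h | h
          · have : x = σ.symm u := by rw [← h]; simp
            grind
          · exact hS1 x hx h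
      · intro x hx hxS
        by_cases hxu : σ x = u
        · simp [hxu]
        · have : x ≠ σ.symm u := by rintro rfl; simp at hxu
          exact Finset.mem_insert_of_mem (hS2 x (by grind) (by grind))
    · push Not at hc
      have hit : ∀ u ∈ Y, ∀ n : ℕ, σ^[n] u ∈ Y := by
        intro u hu n
        induction n with
        | zero => simpa
        | succ n ihn => rw [Function.iterate_succ_apply']; exact hc _ ihn
      have hinv : ∀ u ∈ Y, σ (σ u) = u := fun u hu => h2 u hu (hit u hu)
      obtain ⟨S, hS, hS1, hS2⟩ := ih ((Y.erase u0).erase (σ u0))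
        ((Finset.erase_subset _ _).trans_ssubset (Finset.erase_ssubset hu0))
        (fun x hx hn => hinv x (by grind))
        (fun x hx => h1 x (by grind))
      have hne := h1 u0 hu0
      refine ⟨insert u0 S, by grind, ?_, ?_⟩
      · intro x hx hsx
        rcases Finset.mem_insert.1 hx with rfl | hx
        · rcases Finset.mem_insert.1 hsx with h | h
          · exact hne h
          · have := hS h; grind
        · rcases Finset.mem_insert.1 hsx with h | h
          · have h3 := hinv x (by grind)
            rw [h] at h3
            have := hS hx
            grind
          · exact hS1 x hx h
      · intro x hx hxS
        by_cases hxu : x = σ u0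
        · rw [hxu, hinv u0 hu0]; simp
        · exact Finset.mem_insert_of_mem (hS2 x (by grind) (by grind))

/-- A regular bipartite graph is a union of perfect matchings, by Hall's theorem. -/
theorem exists_perms_of_regular {V : Type*} [Fintype V] (d : ℕ) (r : V → V → Prop)
    (h1 : ∀ u, {w | r u w}.ncard = d) (h2 : ∀ w, {u | r u w}.ncard = d) :
    ∃ f : Fin d → Equiv.Perm V, ∀ u w, r u w ↔ ∃ i, f i u = w := by
  classical
  induction d generalizing r with
  | zero =>
    refine ⟨Fin.elim0, fun u w => ?_⟩
    have := h1 u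
    rw [Set.ncard_eq_zero] at this
    simp only [IsEmpty.exists_iff, iff_false]
    intro h
    exact (Set.ext_iff.1 this w).1 h
  | succ d ih =>
    have c1 : ∀ u, (Finset.univ.filter (r u)).card = d + 1 := by
      intro u
      rw [← h1 u, ← Set.ncard_coe_finset]; simp
    have c2 : ∀ w, (Finset.univ.filter (fun u => r u w)).card = d + 1 := by
      intro w
      rw [← h2 w, ← Set.ncard_coe_finset]; simp
    obtain ⟨g, hg, hgr⟩ := (Finset.all_card_le_biUnion_card_iff_exists_injective
      (fun u => Finset.univ.filter (r u))).1 (by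
        intro s
        have := Finset.card_mul_le_card_mul (s := s)
          (t := s.biUnion fun u => Finset.univ.filter (r u)) r (m := d + 1) (n := d + 1) (by
            intro u hu
            rw [← c1 u]
            apply Finset.card_le_card
            intro w hw
            simp only [Finset.mem_filter, Finset.mem_univ, true_and, Finset.bipartiteAbove,
              Finset.mem_biUnion] at *
            exact ⟨⟨u, hu, hw⟩, hw⟩) (by
            intro w hw
            rw [← c2 w]
            apply Finset.card_le_card
            intro u hu
            simp only [Finset.mem_filter, Finset.mem_univ, true_and, Finset.bipartiteBelow] at *
            exact hu.2)
        exact Nat.le_of_mul_le_mul_right this (Nat.succ_pos d))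
    let f0 : Equiv.Perm V := Equiv.ofBijective g (Finite.injective_iff_bijective.1 hg)
    have hf0 : ∀ u, f0 u = g u := fun _ => rfl
    have hr0 : ∀ u, r u (f0 u) := fun u => by
      have := hgr u
      rw [Finset.mem_filter] at this
      exact this.2
    obtain ⟨f, hf⟩ := ih (fun u w => r u w ∧ f0 u ≠ w) (by
        intro u
        have : {w | r u w ∧ f0 u ≠ w} = {w | r u w} \ {f0 u} := by
          ext w; simp [eq_comm]
        rw [this, Set.ncard_sdiff_singleton_of_mem (s := {w | r u w}) (hr0 u), h1]; rfl) (by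
        intro w
        have : {u | r u w ∧ f0 u ≠ w} = {u | r u w} \ {f0.symm w} := by
          ext u
          simp [Equiv.eq_symm_apply]
        rw [this, Set.ncard_sdiff_singleton_of_mem (s := {u | r u w})
          (by simpa using hr0 (f0.symm w)), h2]; rfl)
    refine ⟨Fin.cons f0 f, fun u w => ?_⟩
    rw [Fin.exists_fin_succ]
    simp only [Fin.cons_zero, Fin.cons_succ]
    rw [← hf]
    by_cases h : f0 u = w
    · subst h
      simp [hr0]
    · simp [h]

theorem exists_involution_of_even {X : Type*} [Finite X] (d : ℕ) (h : Nat.card X = 2 * d) :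
    ∃ b : X → X, (∀ x, b (b x) = x) ∧ ∀ x, b x ≠ x := by
  have : Nat.card X = Nat.card (Fin d × Bool) := by simp [h, mul_comm]
  let e : X ≃ Fin d × Bool := Classical.choice (Finite.card_eq.1 this)
  refine ⟨fun x => e.symm ((e x).1, !(e x).2), fun x => by simp, fun x hx => ?_⟩
  have := congrArg e hx
  simp only [Equiv.apply_symm_apply, Prod.ext_iff] at this
  simp at this

/-- Petersen's theorem: a `2 * d`-regular graph is a union of `d` oriented two-factors. Pairing up
the darts at each vertex, a common transversal of this pairing and of the dart reversal is an
Eulerian orientation, so that the arcs form a `d`-regular bipartite graph. -/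
theorem exists_two_factorization {V : Type*} [Fintype V] (d : ℕ) (K : V → V → Prop)
    (hsymm : ∀ u w, K u w → K w u) (hirr : ∀ u, ¬ K u u)
    (hdeg : ∀ u, {w | K u w}.ncard = 2 * d) :
    ∃ f : Fin d → Equiv.Perm V, ∀ u w, K u w ↔ ((∃ i, f i u = w) ∨ ∃ i, f i w = u) := by
  classical
  have hb : ∀ u, ∃ b : {w // K u w} → {w // K u w}, (∀ x, b (b x) = x) ∧ ∀ x, b x ≠ x :=
    fun u => exists_involution_of_even d (by rw [← hdeg u]; rfl)
  choose b hb1 hb2 using hb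
  let X := {p : V × V // K p.1 p.2}
  let rev : X → X := fun p => ⟨(p.1.2, p.1.1), hsymm _ _ p.2⟩
  let nb : X → X := fun p => ⟨(p.1.1, (b p.1.1 ⟨p.1.2, p.2⟩).1), (b p.1.1 ⟨p.1.2, p.2⟩).2⟩
  obtain ⟨S, hS⟩ := exists_common_transversal rev nb (fun _ => rfl)
    (fun p => by
      apply Subtype.ext
      simp [nb, hb1])
    (fun p h => by
      have : p.1.2 = p.1.1 := congrArg (fun q : X => q.1.1) h
      exact hirr p.1.1 (this ▸ p.2))
    (fun p h => by
      apply hb2 p.1.1 ⟨p.1.2, p.2⟩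
      apply Subtype.ext
      exact congrArg (fun q : X => q.1.2) h)
  let r : V → V → Prop := fun u w => ∃ h : K u w, (⟨(u, w), h⟩ : X) ∈ S
  have hr1 : ∀ u w, K u w → (r w u ↔ ¬ r u w) := by
    intro u w h
    have := (hS ⟨(u, w), h⟩).1
    simp only [r, h, hsymm _ _ h, exists_true_left]
    exact this
  have hhalf : ∀ u, {w | r u w}.ncard = {w | K u w ∧ ¬ r u w}.ncard := by
    intro u
    refine Set.ncard_congr (fun w hw => (b u ⟨w, hw.1⟩).1) ?_ ?_ ?_
    · rintro w ⟨hK, hw⟩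
      refine ⟨(b u ⟨w, hK⟩).2, ?_⟩
      rintro ⟨h1, h2⟩
      exact ((hS ⟨(u, w), hK⟩).2.1 h2) hw
    · intro w w' hw hw' h
      have := congrArg (b u) (Subtype.ext h)
      rw [hb1, hb1] at this
      exact congrArg Subtype.val this
    · rintro w ⟨hK, hw⟩
      refine ⟨(b u ⟨w, hK⟩).1, ⟨(b u ⟨w, hK⟩).2, ?_⟩, ?_⟩
      · exact (hS ⟨(u, w), hK⟩).2.2 (fun h => hw ⟨hK, h⟩)
      · simp [hb1]
  have hsum : ∀ u, {w | r u w}.ncard + {w | K u w ∧ ¬ r u w}.ncard = 2 * d := by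
    intro u
    rw [← hdeg u, ← Set.ncard_union_eq]
    · congr 1
      ext w
      simp only [Set.mem_union, Set.mem_ofPred_eq]
      constructor
      · rintro (⟨h, -⟩ | h)
        · exact h
        · exact h.1
      · intro h
        by_cases h' : r u w
        · exact Or.inl h'
        · exact Or.inr ⟨h, h'⟩
    · rw [Set.disjoint_left]
      rintro w hw ⟨-, hw'⟩
      exact hw' hw
  obtain ⟨f, hf⟩ := exists_perms_of_regular d r (fun u => by
    have := hsum u; have := hhalf u; omega) (fun w => by
    have h1 : {u | r u w} = {u | K w u ∧ ¬ r w u} := by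
      ext u
      constructor
      · intro h
        obtain ⟨h0, -⟩ := id h
        exact ⟨hsymm _ _ h0, (hr1 w u (hsymm _ _ h0)).1 h⟩
      · rintro ⟨h0, h⟩
        exact (hr1 w u h0).2 h
    rw [h1]
    have := hsum w; have := hhalf w; omega)
  refine ⟨f, fun u w => ?_⟩
  rw [← hf, ← hf]
  constructor
  · intro h
    by_cases h' : r u w
    · exact Or.inl h'
    · exact Or.inr ((hr1 u w h).2 h')
  · rintro (⟨h, -⟩ | ⟨h, -⟩)
    · exact h
    · exact hsymm _ _ h

end

/-! ### Consecutive entries of lists and the girth -/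

section

/-- `a` and `b` occur in this order at two consecutive positions of the list `l`. -/
def Consec {V : Type*} (l : List V) (a b : V) : Prop := ∃ s t, l = s ++ a :: b :: t

section Consec

variable {V : Type*} {l l' : List V} {a b : V}

theorem Consec.reverse (h : Consec l a b) : Consec l.reverse b a := by
  obtain ⟨s, t, rfl⟩ := h
  exact ⟨t.reverse, s.reverse, by simp⟩

theorem consec_reverse : Consec l.reverse a b ↔ Consec l b a :=
  ⟨fun h => by simpa using h.reverse, Consec.reverse⟩

theorem Consec.append_left (l' : List V) (h : Consec l a b) : Consec (l' ++ l) a b := by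
  obtain ⟨s, t, rfl⟩ := h
  exact ⟨l' ++ s, t, by simp⟩

theorem Consec.append_right (l' : List V) (h : Consec l a b) : Consec (l ++ l') a b := by
  obtain ⟨s, t, rfl⟩ := h
  exact ⟨s, t ++ l', by simp⟩

theorem Consec.cons (c : V) (h : Consec l a b) : Consec (c :: l) a b :=
  h.append_left [c]

theorem Consec.head : Consec (a :: b :: l) a b := ⟨[], l, rfl⟩

theorem consec_append_cons_cons (s t : List V) : Consec (s ++ a :: b :: t) a b := ⟨s, t, rfl⟩

theorem isChain_iff_consec {R : V → V → Prop} :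
    l.IsChain R ↔ ∀ a b, Consec l a b → R a b := by
  rw [List.isChain_iff_forall_rel_of_append_cons_cons]
  exact ⟨fun h a b ⟨s, t, e⟩ => h e, fun h a b s t e => h a b ⟨s, t, e⟩⟩

theorem consec_iff_getElem :
    Consec l a b ↔ ∃ (i : ℕ) (h : i + 1 < l.length), l[i] = a ∧ l[i + 1] = b := by
  constructor
  · rintro ⟨s, t, rfl⟩
    exact ⟨s.length, by simp, by simp, by simp⟩
  · rintro ⟨i, h, rfl, rfl⟩
    refine ⟨l.take i, l.drop (i + 2), ?_⟩
    rw [List.getElem_cons_drop, List.getElem_cons_drop, List.take_append_drop]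

theorem Consec.of_append (h : Consec (l ++ l') a b) :
    Consec l a b ∨ Consec l' a b ∨ (∃ s t, l = s ++ [a] ∧ l' = b :: t) := by
  obtain ⟨s, t, h⟩ := h
  rcases List.append_eq_append_iff.1 h with ⟨u, rfl, hu⟩ | ⟨u, rfl, hu⟩
  · exact Or.inr (Or.inl ⟨u, t, hu⟩)
  · rcases u with _ | ⟨x, _ | ⟨y, u⟩⟩
    · exact Or.inr (Or.inl ⟨[], t, by simpa using hu.symm⟩)
    · simp only [List.cons_append, List.nil_append, List.cons.injEq] at hu
      exact Or.inr (Or.inr ⟨s, t, by rw [hu.1], hu.2.symm⟩)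
    · simp only [List.cons_append, List.cons.injEq] at hu
      exact Or.inl ⟨s, u, by rw [hu.1, hu.2.1]⟩

end Consec

/-- A family of lists that covers every pair of `D` by consecutive entries, with no more
positions than `D` has pairs, covers each pair of `D` once and nothing else. -/
theorem consec_unique {V : Type*} [Fintype V] (L : V → List V) (D : Finset (V × V))
    (hcov : ∀ d ∈ D, ∃ u, Consec (L u) d.1 d.2) (hcard : ∑ u, ((L u).length - 1) ≤ D.card) :
    (∀ u a b, Consec (L u) a b → (a, b) ∈ D) ∧
      (∀ u w a b, Consec (L u) a b → Consec (L w) a b → u = w) ∧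
      ∑ u, ((L u).length - 1) = D.card := by
  classical
  let P := Σ u, Fin ((L u).length - 1)
  let f : P → V × V := fun p =>
    ((L p.1)[p.2.1]'(by omega), (L p.1)[p.2.1 + 1]'(by omega))
  have hf : ∀ u a b, Consec (L u) a b → ∃ i : Fin ((L u).length - 1), f ⟨u, i⟩ = (a, b) := by
    intro u a b h
    obtain ⟨i, hi, rfl, rfl⟩ := consec_iff_getElem.1 h
    exact ⟨⟨i, by omega⟩, rfl⟩
  have hsub : D ⊆ Finset.univ.image f := by
    intro d hd
    obtain ⟨u, hu⟩ := hcov d hd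
    obtain ⟨i, hi⟩ := hf u _ _ hu
    exact Finset.mem_image.2 ⟨⟨u, i⟩, Finset.mem_univ _, hi⟩
  have hPcard : (Finset.univ : Finset P).card = ∑ u, ((L u).length - 1) := by
    simp [P, Finset.card_univ, Fintype.card_sigma]
  have hP : (Finset.univ : Finset P).card ≤ D.card := hPcard.trans_le hcard
  have h1 := Finset.card_le_card hsub
  have h2 : (Finset.univ.image f).card ≤ (Finset.univ : Finset P).card := Finset.card_image_le
  have heq : D = Finset.univ.image f := Finset.eq_of_subset_of_card_le hsub (h2.trans hP)
  have hinj : Function.Injective f := by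
    have : Set.InjOn f (Finset.univ : Finset P) :=
      Finset.card_image_iff.1 (le_antisymm h2 (hP.trans h1))
    simpa using this
  refine ⟨?_, ?_, hPcard.symm.trans (le_antisymm hP (h1.trans h2))⟩
  · intro u a b h
    obtain ⟨i, hi⟩ := hf u a b h
    rw [heq, ← hi]
    exact Finset.mem_image_of_mem _ (Finset.mem_univ _)
  · intro u w a b hu hw
    obtain ⟨i, hi⟩ := hf u a b hu
    obtain ⟨j, hj⟩ := hf w a b hw
    exact congrArg Sigma.fst (hinj (hi.trans hj.symm))

section Girth

variable {V : Type*} {G : SimpleGraph V}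

theorem exists_walk_of_isChain {l : List V} {a z : V} (hc : l.IsChain G.Adj)
    (ha : l.head? = some a) (hz : l.getLast? = some z) : ∃ p : G.Walk a z, p.support = l := by
  have hne : l ≠ [] := by rintro rfl; simp at ha
  rw [List.head?_eq_some_head hne, Option.some_inj] at ha
  rw [List.getLast?_eq_some_getLast hne, Option.some_inj] at hz
  subst ha hz
  exact ⟨_, SimpleGraph.Walk.support_ofSupport hne hc⟩

theorem egirth_le_of_nodup {l : List V} {a z : V} (hc : l.IsChain G.Adj) (hn : l.Nodup)
    (hl : 3 ≤ l.length) (ha : l.head? = some a) (hz : l.getLast? = some z) (hadj : G.Adj z a) :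
    G.egirth ≤ (l.length : ℕ∞) := by
  obtain ⟨p, hp⟩ := exists_walk_of_isChain hc ha hz
  have hlen : p.length + 1 = l.length := by rw [← hp, SimpleGraph.Walk.length_support]
  have hpath : p.IsPath := by
    rw [SimpleGraph.Walk.isPath_def, hp]; exact hn
  have hcyc : (SimpleGraph.Walk.cons hadj p).IsCycle := by
    rw [SimpleGraph.Walk.cons_isCycle_iff]
    refine ⟨hpath, fun h => ?_⟩
    rw [Sym2.eq_swap] at h
    have := hpath.length_eq_one_of_mem_edges h
    omega
  have := SimpleGraph.egirth_le_length hcyc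
  rwa [SimpleGraph.Walk.length_cons, hlen] at this

/-- In a list of successively adjacent vertices that never traverses an edge in both directions,
a repeated vertex is at least a girth apart. -/
theorem egirth_le_of_repeat {l : List V} (hadj : ∀ a b, Consec l a b → G.Adj a b)
    (hback : ∀ a b, Consec l a b → ¬ Consec l b a) {s m t : List V} {a : V}
    (h : l = s ++ a :: m ++ a :: t) : G.egirth ≤ ((m.length + 1 : ℕ) : ℕ∞) := by
  induction hn : m.length using Nat.strong_induction_on generalizing s m t a with
  | _ n ih =>
    subst hn
    by_cases hnd : (a :: m).Nodup
    · rcases m with _ | ⟨b, _ | ⟨c, m⟩⟩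
      · exact absurd (hadj a a ⟨s, t, by simpa using h⟩) (G.loopless.irrefl a)
      · exact absurd ⟨s ++ [a], t, by simpa using h⟩ (hback a b ⟨s, a :: t, by simpa using h⟩)
      · refine egirth_le_of_nodup (l := a :: b :: c :: m) ?_ hnd (by simp) rfl
          (List.getLast?_eq_some_getLast (by simp)) ?_
        · rw [isChain_iff_consec]
          rintro x y ⟨s', t', e⟩
          refine hadj x y ⟨s ++ s', t' ++ a :: t, ?_⟩
          rw [h, e]; simp
        · refine hadj _ _ ⟨s ++ (a :: b :: c :: m).dropLast, t, ?_⟩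
          conv_lhs => rw [h, ← List.dropLast_append_getLast (l := a :: b :: c :: m) (by simp)]
          simp
    · obtain ⟨x, s', m', t', e⟩ : ∃ x s' m' t', a :: m = s' ++ x :: m' ++ x :: t' := by
        rw [← List.exists_duplicate_iff_not_nodup] at hnd
        obtain ⟨x, hx⟩ := hnd
        rw [List.duplicate_iff_sublist] at hx
        obtain ⟨s1, r1, e1, hs1, h1⟩ := List.cons_sublist_iff.1 hx
        obtain ⟨p1, p2, rfl⟩ := List.append_of_mem hs1
        obtain ⟨q1, q2, rfl⟩ := List.append_of_mem (by simpa using h1)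
        exact ⟨x, p1, p2 ++ q1, q2, by rw [e1]; simp⟩
      have hlen := congrArg List.length e
      simp only [List.length_cons, List.length_append] at hlen
      have := @ih m'.length (by omega) (s ++ s') m' (t' ++ a :: t) x
        (by rw [h, List.append_assoc, List.append_assoc, e]; simp) rfl
      refine this.trans ?_
      exact_mod_cast (by omega : m'.length + 1 ≤ m.length + 1)

end Girth

end

/-! ### Splitting a four-regular graph without bad cycles -/

section

/-- The permutations `α` and `β` orient and split the symmetric relation `H`: its related pairs
are exactly the arcs of `α` and `β` and their reversals. -/
def IsSplitting {V : Type*} (H : V → V → Prop) (α β : Equiv.Perm V) : Prop :=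
  ∀ w z, H w z ↔ α w = z ∨ β w = z ∨ α z = w ∨ β z = w

section Splitting

variable {V : Type*} {H : V → V → Prop} {α β : Equiv.Perm V}

theorem IsSplitting.distinct (h : IsSplitting H α β) (hH : ∀ w, {z | H w z}.ncard = 4) (x : V) :
    α x ≠ β x ∧ α (α x) ≠ x ∧ β (β x) ≠ x ∧ α (β x) ≠ x ∧ β (α x) ≠ x := by
  classical
  have hset : ∀ w, ({α w, β w, α.symm w, β.symm w} : Finset V).card = 4 := by
    intro w
    rw [← hH w, ← Set.ncard_coe_finset]
    congr 1
    ext z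
    simp only [Finset.coe_insert, Finset.coe_singleton, Set.mem_insert_iff,
      Set.mem_singleton_iff, Set.mem_ofPred_eq, h w z, Equiv.eq_symm_apply]
    grind
  have h3 : ∀ a b c : V, ({a, b, c} : Finset V).card ≤ 3 := fun a b c => Finset.card_le_three
  have aux : ∀ w, α w ≠ β w ∧ α w ≠ α.symm w ∧ α w ≠ β.symm w ∧ β w ≠ α.symm w ∧
      β w ≠ β.symm w := by
    intro w
    have h4 := hset w
    refine ⟨fun e => ?_, fun e => ?_, fun e => ?_, fun e => ?_, fun e => ?_⟩ <;>
    · rw [e] at h4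
      have := h3 (α w) (β w) (α.symm w)
      have := h3 (α w) (β w) (β.symm w)
      have := h3 (α w) (α.symm w) (β.symm w)
      have := h3 (β w) (α.symm w) (β.symm w)
      simp only [Finset.mem_insert, Finset.mem_singleton, true_or, or_true,
        Finset.insert_eq_of_mem] at h4
      omega
  obtain ⟨h1, h2, h3', h4, h5⟩ := aux x
  refine ⟨h1, ?_, ?_, ?_, ?_⟩
  · obtain ⟨-, h, -⟩ := aux (α x); simpa using h
  · obtain ⟨-, -, -, -, h⟩ := aux (β x); simpa using h
  · obtain ⟨-, -, h, -, -⟩ := aux (β x); simpa using h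
  · obtain ⟨-, -, -, h, -⟩ := aux (α x); simpa using h

open Classical in
/-- Vertices `u` for which the path that extends from `u` and from `μ u` along `α` is closed to
a cycle by the arc of `β` that leaves its end `α u`. -/
noncomputable def badSet [Fintype V] (μ α β : Equiv.Perm V) : Finset V :=
  Finset.univ.filter fun u => β (α u) = α (μ u)

open Classical in
/-- Vertices whose whole cycle under `u ↦ μ (α u)` is bad, this cycle having length at least
three. -/
noncomputable def badCycleSet [Fintype V] (μ α β : Equiv.Perm V) : Finset V :=
  Finset.univ.filter fun u =>
    (∀ x, (μ * α).SameCycle u x → x ∈ badSet μ α β) ∧ (μ * α) ((μ * α) u) ≠ u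

variable {μ : Equiv.Perm V}

theorem sameCycle_sq_ne {σ : Equiv.Perm V} {u x : V} (h : σ.SameCycle u x) (hu : σ (σ u) ≠ u) :
    σ (σ x) ≠ x := by
  obtain ⟨i, rfl⟩ := h
  intro e
  apply hu
  apply (σ ^ i).injective
  rw [← e]
  have : ∀ y, (σ ^ i) (σ y) = σ ((σ ^ i) y) := fun y => by
    rw [← Equiv.Perm.mul_apply, ← Equiv.Perm.mul_apply, ← zpow_add_one, ← zpow_one_add, add_comm]
  rw [this, this]

variable [Fintype V]

theorem mem_badSet {u : V} : u ∈ badSet μ α β ↔ β (α u) = α (μ u) := by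
  simp [badSet]

theorem mem_badCycleSet {u : V} : u ∈ badCycleSet μ α β ↔
    (∀ x, (μ * α).SameCycle u x → x ∈ badSet μ α β) ∧ μ (α (μ (α u))) ≠ u := by
  classical
  rw [badCycleSet, Finset.mem_filter]
  simp

theorem not_mem_badSet_of_mem (h : IsSplitting H α β) (hH : ∀ w, {z | H w z}.ncard = 4)
    (hμ : ∀ x, μ (μ x) = x) {u : V} (hu : u ∈ badSet μ α β) : μ u ∉ badSet μ α β := by
  intro h'
  rw [mem_badSet] at hu h'
  rw [hμ, ← hu] at h'
  exact (h.distinct hH (α u)).2.2.1 h'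

/-- Exchanging the arcs of `α` and `β` at the other ends `μ r` of the vertices `r` of a bad cycle
makes the bad set smaller, unless each arc of `β` that leaves a vertex `α (μ r)` leads to
`α (μ (α r))`. -/
theorem exists_smaller_badSet (h : IsSplitting H α β) (hH : ∀ w, {z | H w z}.ncard = 4)
    (hμ : ∀ x, μ (μ x) = x) {u₀ : V} (hu₀ : u₀ ∈ badCycleSet μ α β) :
    (∃ α' β', IsSplitting H α' β' ∧ (badSet μ α' β').card < (badSet μ α β).card) ∨
      ∀ r, (μ * α).SameCycle u₀ r → β (α (μ r)) = α (μ (α r)) := by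
  classical
  rw [mem_badCycleSet] at hu₀
  obtain ⟨hZY, hsq⟩ := hu₀
  set Z : V → Prop := fun x => (μ * α).SameCycle u₀ x with hZ
  have hZσ : ∀ x, Z (μ (α x)) ↔ Z x := fun x => Equiv.Perm.sameCycle_apply_right
  have hZμ : ∀ x, Z x → ¬ Z (μ x) := fun x hx hx' =>
    not_mem_badSet_of_mem h hH hμ (hZY x hx) (hZY _ hx')
  have hZsq : ∀ x, Z x → μ (α (μ (α x))) ≠ x := fun x hx => sameCycle_sq_ne hx hsq
  have hZb : ∀ x, Z x → β (α x) = α (μ x) := fun x hx => mem_badSet.1 (hZY x hx)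
  have hpre : ∀ x, Z x → ∃ r, Z r ∧ x = μ (α r) := fun x hx =>
    ⟨α.symm (μ x), by rw [← hZσ]; simpa [hμ] using hx, by simp [hμ]⟩
  by_contra! hcon
  obtain ⟨hmin, r₀, hr₀, hne⟩ := hcon
  have injα : Function.Injective fun x => if Z (μ x) then β x else α x := by
    have key : ∀ x y, Z (μ x) → ¬ Z (μ y) → β x ≠ α y := by
      intro x y hx hy e
      obtain ⟨r, hr, e'⟩ := hpre _ hx
      have : x = α r := by rw [← hμ x, e', hμ]
      rw [this, hZb r hr] at e
      have := α.injective e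
      rw [← this, hμ] at hy
      exact hy hr
    intro x y hxy
    by_cases hx : Z (μ x) <;> by_cases hy : Z (μ y) <;> simp only [hx, hy, if_true, if_false] at hxy
    · exact β.injective hxy
    · exact absurd hxy (key x y hx hy)
    · exact absurd hxy.symm (key y x hy hx)
    · exact α.injective hxy
  have injβ : Function.Injective fun x => if Z (μ x) then α x else β x := by
    have key : ∀ x y, Z (μ x) → ¬ Z (μ y) → α x ≠ β y := by
      intro x y hx hy e
      have h1 := hZb _ hx
      rw [hμ, e] at h1
      have := β.injective h1
      rw [← this, hZσ] at hy
      exact hy hx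
    intro x y hxy
    by_cases hx : Z (μ x) <;> by_cases hy : Z (μ y) <;> simp only [hx, hy, if_true, if_false] at hxy
    · exact α.injective hxy
    · exact absurd hxy (key x y hx hy)
    · exact absurd hxy.symm (key y x hy hx)
    · exact β.injective hxy
  let α' : Equiv.Perm V := Equiv.ofBijective _ (Finite.injective_iff_bijective.1 injα)
  let β' : Equiv.Perm V := Equiv.ofBijective _ (Finite.injective_iff_bijective.1 injβ)
  have hα' : ∀ x, α' x = if Z (μ x) then β x else α x := fun _ => rfl
  have hβ' : ∀ x, β' x = if Z (μ x) then α x else β x := fun _ => rfl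
  have hsplit : IsSplitting H α' β' := by
    intro w z
    rw [h w z, hα', hβ', hα', hβ']
    by_cases hw : Z (μ w) <;> by_cases hz : Z (μ z) <;> simp only [hw, hz, if_true, if_false] <;>
      tauto
  refine absurd (hmin α' β' hsplit) (not_le.2 ?_)
  -- A vertex of the new bad set off the swapped arcs was bad before.
  have hout : ∀ u ∈ badSet μ α' β', ¬ Z (μ u) → u ∈ badSet μ α β ∧ ¬ Z u := by
    intro u hu hZu
    rw [mem_badSet] at hu ⊢
    have e1 : α' u = α u := by rw [hα', if_neg hZu]
    by_cases hu' : Z u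
    · exfalso
      have e2 : α' (μ u) = β (μ u) := by rw [hα', if_pos (by rwa [hμ])]
      have e3 : β' (α u) = α (α u) := by rw [hβ', if_pos ((hZσ u).2 hu')]
      rw [e1, e2, e3] at hu
      obtain ⟨r, hr, e⟩ := hpre u hu'
      have e4 : μ u = α r := by rw [e, hμ]
      rw [e4, hZb r hr] at hu
      apply hZsq u hu'
      rw [α.injective hu, hμ, ← e]
    · have e2 : α' (μ u) = α (μ u) := by rw [hα', if_neg (by rwa [hμ])]
      have e3 : β' (α u) = β (α u) := by rw [hβ', if_neg (by rwa [hZσ])]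
      rw [e1, e2, e3] at hu
      exact ⟨hu, hu'⟩
  have hin : ∀ u ∈ badSet μ α' β', Z (μ u) → μ u ≠ μ (α r₀) := by
    intro u hu hZu e
    have hu1 : u = α r₀ := μ.injective e
    rw [mem_badSet] at hu
    have hZr : Z r₀ := hr₀
    have e1 : α' u = α (μ r₀) := by rw [hα', if_pos hZu, hu1, hZb r₀ hZr]
    have hnZ : ¬ Z (μ (α (μ r₀))) := by rw [hZσ]; exact hZμ _ hZr
    have e2 : α' (μ u) = α (μ u) := by rw [hα', if_neg (by rw [hμ, ← hμ u]; exact hZμ _ hZu)]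
    rw [e1, e2, hβ', if_neg hnZ, hu1] at hu
    exact hne hu
  calc (badSet μ α' β').card ≤ ((badSet μ α β).erase (μ (α r₀))).card := by
        refine Finset.card_le_card_of_injOn (fun u => if Z (μ u) then μ u else u) ?_ ?_
        · intro u hu
          by_cases hZu : Z (μ u)
          · simp only [hZu, if_true, Finset.coe_erase]
            exact ⟨hZY _ hZu, hin u hu hZu⟩
          · simp only [hZu, if_false]
            obtain ⟨h1, h2⟩ := hout u hu hZu
            refine Finset.mem_coe.2 (Finset.mem_erase.2 ⟨?_, h1⟩)
            rintro rfl
            exact h2 ((hZσ _).2 hr₀)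
        · intro u hu v hv e
          by_cases hZu : Z (μ u) <;> by_cases hZv : Z (μ v) <;>
            simp only [hZu, hZv, if_true, if_false] at e
          · exact μ.injective e
          · exact absurd (e ▸ hZu) (hout v hv hZv).2
          · exact absurd (e ▸ hZv) (hout u hu hZu).2
          · exact e
    _ < (badSet μ α β).card := Finset.card_erase_lt_of_mem (hZY _ ((hZσ _).2 hr₀))

/-- If the exchange at a bad cycle does not help, then the vertices `α r` and `α (μ r)` form a cycle
of `β`. Its reversal does not increase the number of bad vertices, and it removes the bad cycle from
`badCycleSet`. -/
theorem exists_smaller_badCycleSet (h : IsSplitting H α β) (hH : ∀ w, {z | H w z}.ncard = 4)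
    (hμ : ∀ x, μ (μ x) = x) {u₀ : V} (hu₀ : u₀ ∈ badCycleSet μ α β)
    (hclosed : ∀ r, (μ * α).SameCycle u₀ r → β (α (μ r)) = α (μ (α r)))
    (hmin : ∀ α' β', IsSplitting H α' β' → (badSet μ α β).card ≤ (badSet μ α' β').card) :
    ∃ β', IsSplitting H α β' ∧ (badSet μ α β').card ≤ (badSet μ α β).card ∧
      (badCycleSet μ α β').card < (badCycleSet μ α β).card := by
  classical
  have hu₀' := hu₀
  rw [mem_badCycleSet] at hu₀
  obtain ⟨hZY, hsq⟩ := hu₀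
  set Z : V → Prop := fun x => (μ * α).SameCycle u₀ x with hZ
  have hZσ : ∀ x, Z (μ (α x)) ↔ Z x := fun x => Equiv.Perm.sameCycle_apply_right
  have hZμ : ∀ x, Z x → ¬ Z (μ x) := fun x hx hx' =>
    not_mem_badSet_of_mem h hH hμ (hZY x hx) (hZY _ hx')
  have hZb : ∀ x, Z x → β (α x) = α (μ x) := fun x hx => mem_badSet.1 (hZY x hx)
  have hpre : ∀ x, Z x → ∃ r, Z r ∧ x = μ (α r) := fun x hx =>
    ⟨α.symm (μ x), by rw [← hZσ]; simpa [hμ] using hx, by simp [hμ]⟩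
  have hinv : ∀ x, Z x → β.symm (α (μ (α x))) = α (μ x) := fun x hx => by
    rw [← hclosed x hx, Equiv.symm_apply_apply]
  -- the vertices of the `β`-cycle that is reversed
  set U : V → Prop := fun x => Z (α.symm x) ∨ Z (μ (α.symm x)) with hU
  have hUα : ∀ x, U (α x) ↔ Z x ∨ Z (μ x) := fun x => by simp [hU]
  have hUβ : ∀ x, U x → U (β x) := by
    intro x hx
    obtain ⟨y, rfl⟩ := α.surjective x
    rcases (hUα y).1 hx with hy | hy
    · rw [hZb y hy, hUα, hμ]; exact Or.inr hy
    · have := hclosed _ hy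
      rw [hμ] at this
      rw [this, hUα, hZσ]; exact Or.inl hy
  have hUβ' : ∀ x, U x → U (β.symm x) := by
    intro x hx
    obtain ⟨y, rfl⟩ := α.surjective x
    rcases (hUα y).1 hx with hy | hy
    · obtain ⟨r, hr, rfl⟩ := hpre y hy
      rw [hinv r hr, hUα, hμ]; exact Or.inr hr
    · have := hZb _ hy
      rw [hμ] at this
      rw [← this, Equiv.symm_apply_apply, hUα]; exact Or.inl hy
  have hUiff : ∀ x, U (β x) ↔ U x := fun x => ⟨fun hx => by simpa using hUβ' _ hx, hUβ x⟩
  have inj : Function.Injective fun x => if U x then β.symm x else β x := by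
    have key : ∀ x y, U x → ¬ U y → β.symm x ≠ β y := by
      intro x y hx hy e
      exact hy ((hUiff y).1 (e ▸ hUβ' x hx))
    intro x y hxy
    by_cases hx : U x <;> by_cases hy : U y <;> simp only [hx, hy, if_true, if_false] at hxy
    · exact β.symm.injective hxy
    · exact absurd hxy (key x y hx hy)
    · exact absurd hxy.symm (key y x hy hx)
    · exact β.injective hxy
  let β' : Equiv.Perm V := Equiv.ofBijective _ (Finite.injective_iff_bijective.1 inj)
  have hβ' : ∀ x, β' x = if U x then β.symm x else β x := fun _ => rfl
  have hsplit : IsSplitting H α β' := by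
    intro w z
    have h1 : ∀ w z, U w → (β' w = z ↔ β z = w) := fun w z hw => by
      rw [hβ', if_pos hw, Equiv.symm_apply_eq, eq_comm]
    have h2 : ∀ w z, ¬ U w → (β' w = z ↔ β w = z) := fun w z hw => by
      rw [hβ', if_neg hw]
    have h3 : ∀ w z, β w = z → (U w ↔ U z) := fun w z e => by rw [← e, hUiff]
    rw [h w z]
    have h5 : ∀ w z, β w = z → β' w = z ∨ β' z = w := fun w z e => by
      by_cases hw : U w
      · exact Or.inr ((h1 z w ((h3 w z e).1 hw)).2 e)
      · exact Or.inl ((h2 w z hw).2 e)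
    have h6 : ∀ w z, β' w = z → β w = z ∨ β z = w := fun w z e => by
      by_cases hw : U w
      · exact Or.inr ((h1 w z hw).1 e)
      · exact Or.inl ((h2 w z hw).1 e)
    constructor
    · rintro (e | e | e | e)
      · exact Or.inl e
      · rcases h5 _ _ e with e | e <;> simp [e]
      · simp [e]
      · rcases h5 _ _ e with e | e <;> simp [e]
    · rintro (e | e | e | e)
      · exact Or.inl e
      · rcases h6 _ _ e with e | e <;> simp [e]
      · simp [e]
      · rcases h6 _ _ e with e | e <;> simp [e]
  have hbad : ∀ u, u ∈ badSet μ α β' ↔ (u ∈ badSet μ α β ∧ ¬ Z u) ∨ Z (μ u) := by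
    intro u
    rw [mem_badSet, mem_badSet, hβ']
    by_cases hu : Z u
    · have := hZμ u hu
      rw [if_pos ((hUα u).2 (Or.inl hu)), Equiv.symm_apply_eq, ← hZb u hu]
      simp only [hu, this, not_true_eq_false, and_false, or_self, iff_false]
      exact fun e => (h.distinct hH _).2.2.1 e.symm
    · by_cases hu' : Z (μ u)
      · have := hZb _ hu'
        rw [hμ] at this
        rw [if_pos ((hUα u).2 (Or.inr hu')), Equiv.symm_apply_eq, this]
        simp [hu']
      · rw [if_neg (by rw [hUα]; tauto)]
        simp [hu, hu']
  have hcard : (badSet μ α β').card ≤ (badSet μ α β).card := by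
    refine Finset.card_le_card_of_injOn (fun u => if Z (μ u) then μ u else u) ?_ ?_
    · intro u hu
      by_cases hZu : Z (μ u)
      · simp only [hZu, if_true]
        exact hZY _ hZu
      · simp only [hZu, if_false]
        rcases (hbad u).1 hu with h' | h'
        · exact h'.1
        · exact absurd h' hZu
    · intro u hu v hv e
      have hu' := (hbad u).1 hu
      have hv' := (hbad v).1 hv
      by_cases hZu : Z (μ u) <;> by_cases hZv : Z (μ v) <;>
        simp only [hZu, hZv, if_true, if_false] at e
      · exact μ.injective e
      · rw [e] at hZu; tauto
      · rw [← e] at hZv; tauto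
      · exact e
  refine ⟨β', hsplit, hcard, Finset.card_lt_card (Finset.ssubset_iff_of_subset ?_ |>.2
    ⟨u₀, hu₀', fun hc => ?_⟩)⟩
  · intro v hv
    obtain ⟨hvY, hvsq⟩ := mem_badCycleSet.1 hv
    refine mem_badCycleSet.2 ⟨fun x hx => ?_, hvsq⟩
    rcases (hbad x).1 (hvY x hx) with h' | h'
    · exact h'.1
    exfalso
    -- a new bad cycle through `x` would be made of closing arcs too, which forces a repeated edge
    rcases exists_smaller_badSet hsplit hH hμ hv with ⟨α'', β'', hs, hlt⟩ | hcl
    · exact absurd (hmin α'' β'' hs) (not_le.2 (hlt.trans_le hcard))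
    · have e1 := hcl x hx
      obtain ⟨r, hr, hxr⟩ := hpre _ h'
      rw [hβ', if_pos ((hUα _).2 (Or.inl h')), hxr, hinv r hr] at e1
      have e2 := α.injective e1
      have e3 : x = α r := by rw [← hμ x, hxr, hμ]
      have e4 := μ.injective e2
      rw [e3] at e4
      exact (h.distinct hH r).2.1 e4.symm
  · have h1 := (mem_badCycleSet.1 hc).1 u₀ (Equiv.Perm.SameCycle.refl _ _)
    have hZ0 : Z u₀ := Equiv.Perm.SameCycle.refl _ _
    rcases (hbad u₀).1 h1 with h' | h'
    · exact h'.2 hZ0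
    · exact hZμ _ hZ0 h'

/-- A splitting with the least possible bad set, and among these with the least set of bad cycles,
has no bad cycle. -/
theorem exists_splitting_badCycleSet_eq_empty (h : IsSplitting H α β)
    (hH : ∀ w, {z | H w z}.ncard = 4) (hμ : ∀ x, μ (μ x) = x) :
    ∃ α' β', IsSplitting H α' β' ∧ badCycleSet μ α' β' = ∅ := by
  classical
  let f : Equiv.Perm V × Equiv.Perm V → ℕ ×ₗ ℕ := fun p =>
    toLex ((badSet μ p.1 p.2).card, (badCycleSet μ p.1 p.2).card)
  obtain ⟨⟨α', β'⟩, hs, hmin⟩ := Set.exists_min_image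
    {p : Equiv.Perm V × Equiv.Perm V | IsSplitting H p.1 p.2} f
    (Set.toFinite _) ⟨(α, β), h⟩
  have hs' : IsSplitting H α' β' := hs
  have hmin' : ∀ α'' β'', IsSplitting H α'' β'' →
      (badSet μ α' β').card < (badSet μ α'' β'').card ∨
      ((badSet μ α' β').card = (badSet μ α'' β'').card ∧
        (badCycleSet μ α' β').card ≤ (badCycleSet μ α'' β'').card) := by
    intro α'' β'' h''
    have := hmin (α'', β'') h''
    simpa [f, Prod.Lex.toLex_le_toLex] using this
  have hmin1 : ∀ α'' β'', IsSplitting H α'' β'' →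
      (badSet μ α' β').card ≤ (badSet μ α'' β'').card := fun α'' β'' h'' => by
    rcases hmin' α'' β'' h'' with h1 | h1
    · exact h1.le
    · exact h1.1.le
  refine ⟨α', β', hs, ?_⟩
  by_contra hne
  obtain ⟨u₀, hu₀⟩ := Finset.nonempty_iff_ne_empty.2 hne
  rcases exists_smaller_badSet hs' hH hμ hu₀ with ⟨α'', β'', h'', hlt⟩ | hcl
  · exact absurd (hmin1 α'' β'' h'') (not_le.2 hlt)
  · obtain ⟨β'', h'', h1, h2⟩ := exists_smaller_badCycleSet hs' hH hμ hu₀ hcl hmin1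
    rcases hmin' α' β'' h'' with h3 | h3
    · omega
    · omega

/-- A splitting together with a set `S` of bad vertices that meets, for each bad vertex `u`,
exactly one of `u` and `μ (α u)`. -/
theorem exists_splitting_kernel (h : IsSplitting H α β)
    (hH : ∀ w, {z | H w z}.ncard = 4) (hμ : ∀ x, μ (μ x) = x) :
    ∃ (α' β' : Equiv.Perm V) (S : Set V), IsSplitting H α' β' ∧
      (∀ u ∈ S, β' (α' u) = α' (μ u)) ∧ (∀ u ∈ S, μ (α' u) ∉ S) ∧
      ∀ u, β' (α' u) = α' (μ u) → u ∉ S → μ (α' u) ∈ S := by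
  classical
  obtain ⟨α', β', h', hO⟩ := exists_splitting_badCycleSet_eq_empty h hH hμ
  obtain ⟨S, hS, hS1, hS2⟩ := exists_kernel (μ * α') (badSet μ α' β') (by
      intro u hu hit
      by_contra hne
      have : u ∈ badCycleSet μ α' β' := by
        refine mem_badCycleSet.2 ⟨fun x hx => ?_, hne⟩
        obtain ⟨n, -, -, rfl⟩ := hx.exists_pow_eq'
        rw [← Equiv.Perm.iterate_eq_pow]
        exact hit n
      rw [hO] at this
      simp at this) (by
      intro u hu he
      rw [mem_badSet] at hu
      have e : μ u = α' u := by
        have := congrArg μ he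
        simpa [hμ] using this.symm
      rw [e] at hu
      exact (h'.distinct hH _).1 hu.symm)
  exact ⟨α', β', S, h', fun u hu => mem_badSet.1 (hS hu), hS1, fun u hu hn =>
    hS2 u (mem_badSet.2 hu) hn⟩

end Splitting

end

/-! ### Path systems -/

section

variable {V : Type*}

/-- Starting from the edges of the matching `m`, each permutation `f` of the list extends all
current trails at both ends: if `R u` leads from `u` to `μ u`, then `R (f u)` leads from `f u`
through `R u` to `f (μ u)`. -/
theorem exists_extension_system (m : Equiv.Perm V) (hm : ∀ x, m (m x) = x) (hm' : ∀ x, m x ≠ x)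
    (fs : List (Equiv.Perm V)) :
    ∃ (μ : Equiv.Perm V) (R : V → List V), (∀ x, μ (μ x) = x) ∧ (∀ x, μ x ≠ x) ∧
      (∀ u, (R u).head? = some u) ∧ (∀ u, R (μ u) = (R u).reverse) ∧
      (∀ u, (R u).length = 2 * fs.length + 2) ∧ (∀ x, ∃ u, Consec (R u) x (m x)) ∧
      ∀ f ∈ fs, ∀ x, ∃ u, Consec (R u) x (f x) := by
  induction fs with
  | nil =>
    exact ⟨m, fun u => [u, m u], hm, hm', fun u => rfl, fun u => by simp [hm], fun u => rfl,
      fun x => ⟨x, Consec.head⟩, by simp⟩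
  | cons f fs ih =>
    obtain ⟨μ, R, h1, h2, h3, h4, h5, h6, h7⟩ := ih
    refine ⟨f.symm.trans (μ.trans f), fun w => w :: R (f.symm w) ++ [f (μ (f.symm w))],
      fun x => by simp [h1], fun x hx => h2 (f.symm x) ?_, fun u => rfl, fun u => ?_, fun u => ?_,
      fun x => ?_, fun g hg x => ?_⟩
    · simpa [← Equiv.eq_symm_apply] using hx
    · simp [h1, h4]
    · simp [h5]; ring
    · obtain ⟨u, hu⟩ := h6 x
      exact ⟨f u, by simpa using (hu.append_right _).cons _⟩
    · rcases List.mem_cons.1 hg with rfl | hg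
      · refine ⟨g (μ x), ?_⟩
        obtain ⟨t, ht⟩ : ∃ t, R x = x :: t := List.head?_eq_some_iff.1 (h3 x)
        simp only [Equiv.symm_apply_apply, h4, h1, ht]
        exact ⟨g (μ x) :: t.reverse, [], by simp⟩
      · obtain ⟨u, hu⟩ := h7 g hg x
        exact ⟨f u, by simpa using (hu.append_right _).cons _⟩

/-- A decomposition of the graph `G` of girth at least `2 * k - 2`, minus the perfect matching of
the involution `ν`, into paths with `2 * k` vertices, each vertex being an end of exactly one of
them: `T w` is the list of vertices of the path with end `w`, read from `w`, and `μ w` is its other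
end. -/
structure PathSystem (G : SimpleGraph V) (ν : V → V) (k : ℕ) where
  three_le : 3 ≤ k
  girth : ((2 * k - 2 : ℕ) : ℕ∞) ≤ G.egirth
  adj_ν : ∀ v, G.Adj v (ν v)
  ν_ν : ∀ v, ν (ν v) = v
  μ : V → V
  T : V → List V
  head : ∀ w, (T w).head? = some w
  rev : ∀ w, T (μ w) = (T w).reverse
  nodup : ∀ w, (T w).Nodup
  length : ∀ w, (T w).length = 2 * k
  adj : ∀ w a b, Consec (T w) a b → G.Adj a b ∧ b ≠ ν a
  unique : ∀ u w a b, Consec (T u) a b → Consec (T w) a b → u = w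
  cover : ∀ a b, G.Adj a b → b ≠ ν a → ∃ w, Consec (T w) a b

theorem card_filter_pairs [Fintype V] (D : V → V → Prop) [∀ a, DecidablePred (D a)] (c : ℕ)
    (h : ∀ a, {b | D a b}.ncard = c) :
    (Finset.univ.filter fun p : V × V => D p.1 p.2).card = Fintype.card V * c := by
  classical
  rw [Finset.card_filter, Fintype.sum_prod_type]
  have : ∀ a, (∑ b, if D a b then 1 else 0) = c := fun a => by
    rw [← Finset.card_filter, ← h a, ← Set.ncard_coe_finset]
    exact congrArg Set.ncard (Set.ext fun b => by simp)
  refine (Finset.sum_congr rfl fun a _ => this a).trans ?_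
  rw [Finset.sum_const, Finset.card_univ, smul_eq_mul]

/-- A family of lists with `2 * k` entries that covers all pairs of adjacent vertices not matched
by `ν` is a path system, once no list begins with its last or second to last entry. -/
theorem nonempty_pathSystem_of_cover [Fintype V] {G : SimpleGraph V} {ν : V → V} {k : ℕ}
    (hk : 3 ≤ k) (hg : ((2 * k - 2 : ℕ) : ℕ∞) ≤ G.egirth)
    (hdeg : ∀ v, {w | G.Adj v w}.ncard = 2 * k) (hν : ∀ v, G.Adj v (ν v))
    (hνν : ∀ v, ν (ν v) = v) (μ : V → V) (hμ' : ∀ x, μ x ≠ x) (F : V → List V)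
    (hrev : ∀ u, F (μ u) = (F u).reverse) (hlen : ∀ u, (F u).length = 2 * k)
    (hcov : ∀ a b, G.Adj a b → b ≠ ν a → ∃ u, Consec (F u) a b)
    (hhead : ∀ v, ∃ u, (F u).head? = some v)
    (hpen : (∀ u a b, Consec (F u) a b → G.Adj a b) → ∀ u a s c, F u ≠ a :: s ++ [a, c]) :
    Nonempty (PathSystem G ν k) := by
  classical
  have hD := card_filter_pairs (fun a b => G.Adj a b ∧ b ≠ ν a) (2 * k - 1) (fun a => by
    have : {b | G.Adj a b ∧ b ≠ ν a} = {b | G.Adj a b} \ {ν a} := rfl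
    rw [this, Set.ncard_sdiff_singleton_of_mem (s := {b | G.Adj a b}) (hν a), hdeg])
  obtain ⟨hadj, huniq, -⟩ := consec_unique F
      (Finset.univ.filter fun p : V × V => G.Adj p.1 p.2 ∧ p.2 ≠ ν p.1) (fun d hd => by
    simp only [Finset.mem_filter, Finset.mem_univ, true_and] at hd
    exact hcov _ _ hd.1 hd.2) (le_of_eq (by rw [hD]; simp [hlen, Finset.card_univ]))
  simp only [Finset.mem_filter, Finset.mem_univ, true_and] at hadj
  have hne : ∀ u, F u ≠ [] := fun u h => by have := hlen u; rw [h] at this; simp at this; omega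
  let h : V → V := fun u => (F u).head (hne u)
  have hh : ∀ u, (F u).head? = some (h u) := fun u => List.head?_eq_some_head _
  have hsurj : Function.Surjective h := fun v => by
    obtain ⟨u, hu⟩ := hhead v
    exact ⟨u, by rw [hh] at hu; exact Option.some.inj hu⟩
  have hinj : Function.Injective h := Finite.injective_iff_surjective.2 hsurj
  let e : V ≃ V := Equiv.ofBijective h ⟨hinj, hsurj⟩
  have hnodup : ∀ u, (F u).Nodup := by
    intro u
    by_contra hnd
    -- a repetition closes a cycle, and by the girth at most one entry of the list lies outside it
    obtain ⟨x, s, m, t, hx⟩ : ∃ x s m t, F u = s ++ x :: m ++ x :: t := by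
      rw [← List.exists_duplicate_iff_not_nodup] at hnd
      obtain ⟨x, hx⟩ := hnd
      rw [List.duplicate_iff_sublist] at hx
      obtain ⟨s1, r1, e1, hs1, h1⟩ := List.cons_sublist_iff.1 hx
      obtain ⟨p1, p2, rfl⟩ := List.append_of_mem hs1
      obtain ⟨q1, q2, rfl⟩ := List.append_of_mem (by simpa using h1)
      exact ⟨x, p1, p2 ++ q1, q2, by rw [e1]; simp⟩
    have hgm := egirth_le_of_repeat (fun a b hab => (hadj u a b hab).1) (fun a b h1 h2 => by
      have h3 : Consec (F (μ u)) a b := by rw [hrev, consec_reverse]; exact h2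
      exact hμ' u (huniq _ _ _ _ h3 h1)) hx
    have h1 : 2 * k - 2 ≤ m.length + 1 := by exact_mod_cast hg.trans hgm
    have h2 := hlen u
    rw [hx] at h2
    simp only [List.length_append, List.length_cons] at h2
    have h3 : s.length + t.length ≤ 1 := by omega
    have hadj' : ∀ u a b, Consec (F u) a b → G.Adj a b := fun u a b hab => (hadj u a b hab).1
    rcases s with _ | ⟨c, s⟩
    · rcases t with _ | ⟨c, t⟩
      · apply hμ' u
        apply hinj
        have h4 := hh (μ u)
        have h5 := hh u
        rw [hrev, hx] at h4
        rw [hx] at h5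
        simp at h4 h5
        rw [← h4, ← h5]
      · have : t = [] := by
          simp at h3; exact h3
        subst this
        exact hpen hadj' u x m c (by rw [hx]; simp)
    · have : s = [] ∧ t = [] := by
        rw [← List.length_eq_zero_iff, ← List.length_eq_zero_iff]
        simp at h3; omega
      obtain ⟨rfl, rfl⟩ := this
      refine hpen hadj' (μ u) x m.reverse c ?_
      rw [hrev, hx]; simp
  exact ⟨{
    three_le := hk
    girth := hg
    adj_ν := hν
    ν_ν := hνν
    μ := fun w => e (μ (e.symm w))
    T := fun w => F (e.symm w)
    head := fun w => by
      rw [hh]; congr 1; exact e.apply_symm_apply w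
    rev := fun w => by simp [hrev]
    nodup := fun w => hnodup _
    length := fun w => hlen _
    adj := fun w a b hab => hadj _ a b hab
    unique := fun u w a b h1 h2 => e.symm.injective (huniq _ _ _ _ h1 h2)
    cover := fun a b h1 h2 => by
      obtain ⟨u, hu⟩ := hcov a b h1 h2
      exact ⟨e u, by simpa using hu⟩ }⟩

end

/-! ### Construction of a path system -/

section

variable {V : Type*}

theorem exists_eq_cons_append_of_head?_of_reverse {μ : V → V} {R : V → List V}
    (hμ' : ∀ x, μ x ≠ x) (h : ∀ u, (R u).head? = some u) (hr : ∀ u, R (μ u) = (R u).reverse)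
    (u : V) : ∃ r, R u = u :: r ++ [μ u] := by
  obtain ⟨t, ht⟩ : ∃ t, R u = u :: t := List.head?_eq_some_iff.1 (h u)
  obtain ⟨t', ht'⟩ : ∃ t, R (μ u) = μ u :: t := List.head?_eq_some_iff.1 (h (μ u))
  rw [hr] at ht'
  have h1 : R u = t'.reverse ++ [μ u] := by
    rw [← List.reverse_reverse (R u), ht']; simp
  rcases hs : t'.reverse with _ | ⟨x, r⟩
  · rw [hs, ht] at h1
    simp at h1
    exact absurd h1.1.symm (hμ' u)
  · rw [hs] at h1
    rw [h1] at ht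
    simp at ht
    exact ⟨r, by rw [h1, ht.1]⟩

/-- The trails `R u` with `2 * k - 4` vertices are extended along the last two two-factors `α` and
`β`. In general, two vertices are added at each end, first along `α` and then along `β`. At a vertex
`u` of the kernel `S` of the bad set this would close a cycle, and instead the arc of `β` from `α u`
to `α (μ u)` is used: three vertices are added at the end `u` and one, along `β`, at the end `μ u`.
The arc of `β` at `μ u` is then used up, so a trail that arrives at `μ u` along `α` goes on along
the arc of `α` at `μ u`, which is free. -/
theorem nonempty_pathSystem_of_splitting [Fintype V] {G : SimpleGraph V} {ν : V → V} {k : ℕ}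
    (hk : 3 ≤ k) (hg : ((2 * k - 2 : ℕ) : ℕ∞) ≤ G.egirth)
    (hdeg : ∀ v, {w | G.Adj v w}.ncard = 2 * k) (hν : ∀ v, G.Adj v (ν v))
    (hνν : ∀ v, ν (ν v) = v)
    (μ : Equiv.Perm V) (hμ : ∀ x, μ (μ x) = x) (hμ' : ∀ x, μ x ≠ x) (R : V → List V)
    (hhead : ∀ u, (R u).head? = some u) (hrev : ∀ u, R (μ u) = (R u).reverse)
    (hlen : ∀ u, (R u).length = 2 * k - 4) {H : V → V → Prop} {α₀ β₀ : Equiv.Perm V}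
    (h₀ : IsSplitting H α₀ β₀) (hH : ∀ w, {z | H w z}.ncard = 4)
    (hcov : ∀ a b, G.Adj a b → b ≠ ν a → (∃ u, Consec (R u) a b) ∨ H a b) :
    Nonempty (PathSystem G ν k) := by
  classical
  obtain ⟨α, β, S, hs, hS1, hS2, hS3⟩ := exists_splitting_kernel h₀ hH hμ
  have hd := hs.distinct hH
  have hSμ : ∀ u, u ∈ S → μ u ∉ S := by
    intro u hu hu'
    have h1 := hS1 u hu
    have h2 := hS1 _ hu'
    rw [hμ, ← h1] at h2
    exact (hd (α u)).2.2.1 h2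
  -- a trail that arrives at `x` along `α` ends at `ε x`: if `μ x ∈ S`, the arc of `β` at `x` is
  -- used up
  let ε : V → V := fun x => if μ x ∈ S then α x else β x
  have hε1 : ∀ x, μ x ∈ S → ε x = α x := fun x h => if_pos h
  have hε2 : ∀ x, μ x ∉ S → ε x = β x := fun x h => if_neg h
  let F : V → List V := fun u =>
    if u ∈ S then ε (α (μ u)) :: α (μ u) :: α u :: R u ++ [β (μ u)]
    else if μ u ∈ S then β u :: R u ++ [α (μ u), α u, ε (α u)]
    else ε (α u) :: α u :: R u ++ [α (μ u), ε (α (μ u))]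
  have hF1 : ∀ u, u ∈ S → F u = ε (α (μ u)) :: α (μ u) :: α u :: R u ++ [β (μ u)] :=
    fun u h => if_pos h
  have hF2 : ∀ u, μ u ∈ S → F u = β u :: R u ++ [α (μ u), α u, ε (α u)] := fun u h => by
    have : u ∉ S := fun h' => hSμ u h' h
    simp only [F, this, h, if_true, if_false]
  have hF3 : ∀ u, u ∉ S → μ u ∉ S →
      F u = ε (α u) :: α u :: R u ++ [α (μ u), ε (α (μ u))] := fun u h h' => by
    simp only [F, h, h', if_false]
  have hR := fun u => (List.head?_eq_some_iff (a := u)).1 (hhead u)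
  have hFrev : ∀ u, F (μ u) = (F u).reverse := by
    intro u
    by_cases h1 : u ∈ S
    · rw [hF1 u h1, hF2 (μ u) (by rwa [hμ])]
      simp [hrev, hμ]
    · by_cases h2 : μ u ∈ S
      · rw [hF2 u h2, hF1 (μ u) h2]
        simp [hrev, hμ]
      · rw [hF3 u h1 h2, hF3 (μ u) h2 (by rwa [hμ])]
        simp [hrev, hμ]
  have hRF : ∀ u a b, Consec (R u) a b → Consec (F u) a b := by
    intro u a b h
    by_cases h1 : u ∈ S
    · rw [hF1 u h1]
      exact (((h.cons _).cons _).cons _).append_right _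
    · by_cases h2 : μ u ∈ S
      · rw [hF2 u h2]
        exact (h.cons _).append_right _
      · rw [hF3 u h1 h2]
        exact ((h.cons _).cons _).append_right _
  have hstart : ∀ u, u ∉ S → ∃ w t, F w = ε (α u) :: α u :: t := by
    intro u h1
    by_cases h2 : μ u ∈ S
    · exact ⟨μ u, _, by rw [hF1 _ h2, hμ]; rfl⟩
    · exact ⟨u, _, by rw [hF3 _ h1 h2]; rfl⟩
  have hbadnext : ∀ u, u ∈ S → ∃ w t, F w = β (α u) :: μ u :: t := by
    intro u hu
    -- the trail that arrives at `μ u` along `α` goes on to `α (μ u)`, which is `β (α u)`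
    have h1 : α.symm (μ u) ∉ S := fun h => hS2 _ h (by simpa [hμ] using hu)
    obtain ⟨w, t, hw⟩ := hstart _ h1
    refine ⟨w, t, ?_⟩
    rw [hw, Equiv.apply_symm_apply, hε1 _ (by rwa [hμ]), hS1 u hu]
  have hcovα : ∀ x, ∃ u, Consec (F u) (α x) x := by
    intro x
    obtain ⟨t, ht⟩ := hR x
    by_cases h2 : μ x ∈ S
    · obtain ⟨w, t', hw⟩ := hbadnext _ h2
      refine ⟨w, ?_⟩
      rw [hw, hS1 _ h2, hμ]
      exact Consec.head
    · by_cases h1 : x ∈ S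
      · exact ⟨x, [ε (α (μ x)), α (μ x)], t ++ [β (μ x)], by rw [hF1 x h1, ht]; simp⟩
      · exact ⟨x, [ε (α x)], t ++ [α (μ x), ε (α (μ x))], by rw [hF3 x h1 h2, ht]; simp⟩
  have hcovβ : ∀ x, ∃ u, Consec (F u) (β x) x := by
    intro x
    by_cases h2 : μ x ∈ S
    · obtain ⟨t, ht⟩ := hR x
      exact ⟨x, by rw [hF2 x h2, ht]; exact Consec.head⟩
    · obtain ⟨u, rfl⟩ := α.surjective x
      by_cases h1 : u ∈ S
      · refine ⟨u, ?_⟩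
        rw [hF1 u h1, hS1 u h1]
        exact Consec.head.cons _
      · obtain ⟨w, t, hw⟩ := hstart u h1
        refine ⟨w, ?_⟩
        rw [hw, hε2 _ h2]
        exact Consec.head
  have hswap : ∀ a b, (∃ u, Consec (F u) a b) → ∃ u, Consec (F u) b a := by
    rintro a b ⟨u, hu⟩
    exact ⟨μ u, by rw [hFrev]; exact hu.reverse⟩
  refine nonempty_pathSystem_of_cover hk hg hdeg hν hνν μ hμ' F hFrev ?_ ?_ ?_ ?_
  · intro u
    have := hlen u
    by_cases h1 : u ∈ S
    · rw [hF1 u h1]; simp; omega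
    · by_cases h2 : μ u ∈ S
      · rw [hF2 u h2]; simp; omega
      · rw [hF3 u h1 h2]; simp; omega
  · intro a b hab hb
    rcases hcov a b hab hb with ⟨u, hu⟩ | h
    · exact ⟨u, hRF u a b hu⟩
    · rcases (hs a b).1 h with rfl | rfl | rfl | rfl
      · exact hswap _ _ (hcovα a)
      · exact hswap _ _ (hcovβ a)
      · exact hcovα b
      · exact hcovβ b
  · intro v
    obtain ⟨x, rfl⟩ := β.surjective v
    by_cases h2 : μ x ∈ S
    · exact ⟨x, by rw [hF2 x h2]; rfl⟩
    · obtain ⟨u, rfl⟩ := α.surjective x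
      by_cases h1 : u ∈ S
      · obtain ⟨w, t, hw⟩ := hbadnext u h1
        exact ⟨w, by rw [hw]; rfl⟩
      · obtain ⟨w, t, hw⟩ := hstart u h1
        exact ⟨w, by rw [hw, hε2 _ h2]; rfl⟩
  · -- if `u, μ u ∉ S`, the first entry is the last but one only if `u` is bad and `μ (α u) ∉ S`,
    -- which the kernel excludes
    intro hadj u a s c hu
    obtain ⟨r, hr⟩ := exists_eq_cons_append_of_head?_of_reverse hμ' hhead hrev u
    by_cases h1 : u ∈ S
    · have e : (ε (α (μ u)) :: α (μ u) :: α u :: u :: r) ++ [μ u, β (μ u)] =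
          (a :: s) ++ [a, c] := by
        rw [← hu, hF1 u h1, hr]; simp
      obtain ⟨e1, e2⟩ := List.append_inj' e rfl
      have e3 : ε (α (μ u)) = μ u := by
        rw [(List.cons.inj e1).1, (List.cons.inj e2).1]
      by_cases h3 : μ (α (μ u)) ∈ S
      · rw [hε1 _ h3] at e3; exact (hd _).2.1 e3
      · rw [hε2 _ h3] at e3; exact (hd _).2.2.2.2 e3
    · by_cases h2 : μ u ∈ S
      · have e : (β u :: R u ++ [α (μ u)]) ++ [α u, ε (α u)] = (a :: s) ++ [a, c] := by
          rw [← hu, hF2 u h2]; simp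
        obtain ⟨e1, e2⟩ := List.append_inj' e rfl
        have e3 : β u = α u := by
          rw [(List.cons.inj e1).1, (List.cons.inj e2).1]
        exact (hd u).1 e3.symm
      · have e : (ε (α u) :: α u :: R u) ++ [α (μ u), ε (α (μ u))] = (a :: s) ++ [a, c] := by
          rw [← hu, hF3 u h1 h2]
        obtain ⟨e1, e2⟩ := List.append_inj' e rfl
        have e3 : ε (α u) = α (μ u) := by
          rw [(List.cons.inj e1).1, (List.cons.inj e2).1]
        by_cases h3 : μ (α u) ∈ S
        · rw [hε1 _ h3] at e3
          have := α.injective e3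
          rw [this, hμ] at h3
          exact h1 h3
        · rw [hε2 _ h3] at e3
          exact h3 (hS3 u e3 h1)

/-- A `2 * k`-regular graph of girth at least `2 * k - 2` with two disjoint perfect matchings,
given by the involutions `m` and `ν`, has a path system for `ν`. -/
theorem nonempty_pathSystem [Fintype V] {G : SimpleGraph V} {m ν : V → V} {k : ℕ}
    (hk : 3 ≤ k) (hg : ((2 * k - 2 : ℕ) : ℕ∞) ≤ G.egirth)
    (hdeg : ∀ v, {w | G.Adj v w}.ncard = 2 * k) (hν : ∀ v, G.Adj v (ν v))
    (hνν : ∀ v, ν (ν v) = v) (hm : ∀ v, G.Adj v (m v)) (hmm : ∀ v, m (m v) = v)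
    (hmν : ∀ v, m v ≠ ν v) : Nonempty (PathSystem G ν k) := by
  classical
  obtain ⟨j, rfl⟩ : ∃ j, k = j + 3 := ⟨k - 3, by omega⟩
  let K : V → V → Prop := fun a b => G.Adj a b ∧ b ≠ ν a ∧ b ≠ m a
  have hKcard : ∀ u, {w | K u w}.ncard = 2 * (j + 2) := by
    intro u
    have : {w | K u w} = ({w | G.Adj u w} \ {ν u}) \ {m u} := by
      ext w; simp [K, and_assoc]
    rw [this, Set.ncard_sdiff_singleton_of_mem (s := {w | G.Adj u w} \ {ν u}) ⟨hm u, hmν u⟩,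
      Set.ncard_sdiff_singleton_of_mem (s := {w | G.Adj u w}) (hν u), hdeg]
    omega
  obtain ⟨f, hf⟩ := exists_two_factorization (j + 2) K (fun u w ⟨h1, h2, h3⟩ =>
    ⟨h1.symm, fun e => h2 (by rw [e, hνν]), fun e => h3 (by rw [e, hmm])⟩)
    (fun u h => G.loopless.irrefl u h.1) hKcard
  -- by counting, the ends of the arcs at a vertex are distinct
  let g : V → Fin (j + 2) ⊕ Fin (j + 2) → V := fun w => Sum.elim (fun i => f i w)
    (fun i => (f i).symm w)
  have hg' : ∀ w, Function.Injective (g w) := by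
    intro w
    have h1 : Finset.univ.image (g w) = Finset.univ.filter (K w) := by
      ext z
      simp only [Finset.mem_image, Finset.mem_univ, true_and, Sum.exists, Finset.mem_filter, hf,
        g, Sum.elim_inl, Sum.elim_inr, Equiv.symm_apply_eq]
      simp only [eq_comm]
    have h2 : (Finset.univ.image (g w)).card =
        (Finset.univ : Finset (Fin (j + 2) ⊕ Fin (j + 2))).card := by
      rw [h1, Finset.card_univ, Fintype.card_sum, Fintype.card_fin, ← two_mul, ← hKcard w,
        ← Set.ncard_coe_finset]
      congr 1
      ext z
      simp
    have := Finset.card_image_iff.1 h2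
    simpa using this
  let α := f ⟨j, by omega⟩
  let β := f ⟨j + 1, by omega⟩
  let H : V → V → Prop := fun w z => α w = z ∨ β w = z ∨ α z = w ∨ β z = w
  have hH : ∀ w, {z | H w z}.ncard = 4 := by
    intro w
    have h1 : {z | H w z} = g w '' {Sum.inl ⟨j, by omega⟩, Sum.inl ⟨j + 1, by omega⟩,
        Sum.inr ⟨j, by omega⟩, Sum.inr ⟨j + 1, by omega⟩} := by
      ext z
      simp only [H, α, β, g, Set.mem_ofPred_eq, Set.image_insert_eq, Set.image_singleton,
        Sum.elim_inl, Sum.elim_inr, Set.mem_insert_iff, Set.mem_singleton_iff,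
        Equiv.eq_symm_apply]
      simp only [eq_comm]
    rw [h1, Set.ncard_image_of_injective _ (hg' w)]
    rw [Set.ncard_insert_of_notMem, Set.ncard_insert_of_notMem, Set.ncard_pair] <;> simp
  obtain ⟨μ, R, h1, h2, h3, h4, h5, h6, h7⟩ := exists_extension_system
    (Function.Involutive.toPerm m hmm) hmm (fun x e => (hm x).ne e.symm)
    ((List.finRange j).map fun i : Fin j => f ⟨i.1, by omega⟩)
  refine nonempty_pathSystem_of_splitting hk hg hdeg hν hνν μ h1 h2 R h3 h4
    (fun u => by rw [h5]; simp; omega) (H := H) (α₀ := α) (β₀ := β) (fun w z => Iff.rfl) hH ?_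
  intro a b hab hb
  by_cases hbm : b = m a
  · subst hbm
    exact Or.inl (h6 a)
  have key : ∀ i a, (∃ u, Consec (R u) a (f i a)) ∨ α a = f i a ∨ β a = f i a := by
    intro i a
    rcases lt_trichotomy i.1 j with hi | hi | hi
    · refine Or.inl (h7 _ (List.mem_map.2 ⟨⟨i.1, hi⟩, List.mem_finRange _, rfl⟩) a)
    · exact Or.inr (Or.inl (by simp only [α, ← hi]))
    · have : i.1 = j + 1 := by omega
      exact Or.inr (Or.inr (by simp only [β, ← this]))
  rcases (hf a b).1 ⟨hab, hb, hbm⟩ with ⟨i, rfl⟩ | ⟨i, rfl⟩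
  · rcases key i a with h | h | h
    · exact Or.inl h
    · exact Or.inr (Or.inl h)
    · exact Or.inr (Or.inr (Or.inl h))
  · rcases key i b with ⟨u, h⟩ | h | h
    · exact Or.inl ⟨μ u, by rw [h4]; exact h.reverse⟩
    · exact Or.inr (Or.inr (Or.inr (Or.inl h)))
    · exact Or.inr (Or.inr (Or.inr (Or.inr h)))

end

/-! ### Bad ends and rotations -/

section

variable {V : Type*} {G : SimpleGraph V} {ν : V → V} {k : ℕ}

namespace PathSystem

variable (P : PathSystem G ν k)

theorem μ_μ (w : V) : P.μ (P.μ w) = w := by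
  have h := P.head (P.μ (P.μ w))
  rw [P.rev, P.rev, List.reverse_reverse, P.head] at h
  exact (Option.some.inj h).symm

theorem μ_ne (w : V) : P.μ w ≠ w := by
  intro h
  obtain ⟨t, ht⟩ := List.head?_eq_some_iff.1 (P.head w)
  have h1 := P.length w
  have h2 := P.nodup w
  have h3 := P.rev w
  have := P.three_le
  rw [h, ht] at h3
  rcases List.eq_nil_or_concat t with rfl | ⟨t, x, rfl⟩
  · rw [ht] at h1; simp at h1; omega
  · rw [ht] at h2
    simp at h3
    simp [h3.1] at h2

theorem exists_T_eq (w : V) : ∃ r, P.T w = w :: r ++ [P.μ w] :=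
  exists_eq_cons_append_of_head?_of_reverse P.μ_ne P.head P.rev w

theorem mem_T_μ {w x : V} : x ∈ P.T (P.μ w) ↔ x ∈ P.T w := by
  rw [P.rev, List.mem_reverse]

theorem ν_ne (P : PathSystem G ν k) (w : V) : ν w ≠ w := (P.adj_ν w).ne'

theorem consec_T_μ {w a b : V} : Consec (P.T (P.μ w)) a b ↔ Consec (P.T w) b a := by
  rw [P.rev, consec_reverse]

theorem not_adj_of_short (P : PathSystem G ν k) {l : List V} {a z : V} (hc : l.IsChain G.Adj)
    (hn : l.Nodup) (hl : 3 ≤ l.length) (hl' : l.length < 2 * k - 2) (ha : l.head? = some a)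
    (hz : l.getLast? = some z) : ¬ G.Adj z a := by
  intro hadj
  have h : 2 * k - 2 ≤ l.length := by
    exact_mod_cast P.girth.trans (egirth_le_of_nodup hc hn hl ha hz hadj)
  omega

theorem no_triangle (P : PathSystem G ν k) {a b c : V} (hab : G.Adj a b) (hbc : G.Adj b c) :
    ¬ G.Adj c a := by
  intro hca
  have := P.three_le
  exact P.not_adj_of_short (l := [a, b, c]) (by simp [hab, hbc])
    (by simp [hab.ne, hbc.ne, hca.ne']) (by simp) (by simp; omega) rfl rfl hca

theorem isChain_T (w : V) : (P.T w).IsChain G.Adj :=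
  isChain_iff_consec.2 fun a b h => (P.adj w a b h).1

/-- Two vertices of the same path that are adjacent, but not along the path, are at distance at
least `2 * k - 3` on the path. -/
theorem length_of_chord {w x y : V} {s t r : List V} (h : P.T w = s ++ x :: t ++ y :: r)
    (hxy : G.Adj x y) (ht : t ≠ []) : 2 * k ≤ t.length + 4 := by
  by_contra hlt
  have hc := P.isChain_T w
  have hn := P.nodup w
  have e : P.T w = s ++ ((x :: t ++ [y]) ++ r) := by rw [h]; simp
  rw [e] at hc hn
  have := List.length_pos_iff.2 ht
  exact P.not_adj_of_short (hc.right_of_append.left_of_append)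
    (hn.of_append_right.of_append_left) (by simp; omega)
    (by simp; omega) (a := x) (z := y) rfl List.getLast?_concat hxy.symm

/-- Because of the girth, a chord of a path of the system at its end `w` goes to one of the two
vertices that are next to the last one. -/
theorem exists_of_chord {w x : V} (hx : x ∈ P.T w) (hwx : G.Adj w x) (hμ : x ≠ P.μ w)
    (hc : ¬ Consec (P.T w) w x) :
    ∃ A z B, P.T w = w :: A ++ z :: x :: B ∧ (B = [P.μ w] ∨ ∃ a, B = [a, P.μ w]) := by
  obtain ⟨r, hr⟩ := P.exists_T_eq w
  have hxr : x ∈ r := by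
    rw [hr] at hx
    simpa [hwx.ne', hμ] using hx
  obtain ⟨r1, r2, rfl⟩ := List.append_of_mem hxr
  have h1 : r1 ≠ [] := by
    rintro rfl
    exact hc (by rw [hr]; exact Consec.head)
  have h2 := P.length_of_chord (s := []) (t := r1) (r := r2 ++ [P.μ w]) (by rw [hr]; simp) hwx h1
  have h3 := P.length w
  rw [hr] at h3
  simp at h3
  obtain ⟨A, z, rfl⟩ := List.eq_nil_or_concat r1 |>.resolve_left h1
  refine ⟨A, z, r2 ++ [P.μ w], by rw [hr]; simp, ?_⟩
  rcases r2 with _ | ⟨a, _ | ⟨b, r2⟩⟩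
  · exact Or.inl rfl
  · exact Or.inr ⟨a, rfl⟩
  · simp at h2 h3; omega

/-- The edge of the matching `ν` at `w` joins `w` to an inner vertex of the path with end `w`. -/
def IsBad (w : V) : Prop := ν w ∈ P.T w ∧ ν w ≠ P.μ w

open Classical in
/-- The part of the path with end `w` before `ν w`. -/
noncomputable def pre (w : V) : List V := (P.T w).takeWhile (· ≠ ν w)

open Classical in
/-- The part of the path with end `w` from `ν w` on. -/
noncomputable def suf (w : V) : List V := (P.T w).dropWhile (· ≠ ν w)

/-- The vertex before `ν w` on the path with end `w`; only used if `w` is bad. -/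
noncomputable def z (w : V) : V := (P.pre w).getLastD w

variable {P}

theorem IsBad.exists_split {w : V} (h : P.IsBad w) :
    ∃ A B, P.pre w = w :: A ++ [P.z w] ∧ P.suf w = ν w :: B ∧
      P.T w = w :: A ++ P.z w :: ν w :: B ∧ (B = [P.μ w] ∨ ∃ a, B = [a, P.μ w]) := by
  obtain ⟨A, z, B, h1, h2⟩ := P.exists_of_chord h.1 (P.adj_ν w) h.2
    (fun hc => (P.adj _ _ _ hc).2 rfl)
  have hn := P.nodup w
  have hne : ∀ c ∈ w :: A ++ [z], c ≠ ν w := by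
    have e : P.T w = (w :: A ++ [z]) ++ (ν w :: B) := by rw [h1]; simp
    rw [e] at hn
    intro c hc
    exact (List.nodup_append.1 hn).2.2 c hc _ (by simp)
  have e : P.T w = (w :: A ++ [z]) ++ (ν w :: B) := by rw [h1]; simp
  have hpre : P.pre w = w :: A ++ [z] := by
    rw [pre, e, List.takeWhile_append_of_pos (by simpa using hne)]
    simp
  have hsuf : P.suf w = ν w :: B := by
    rw [suf, e, List.dropWhile_append_of_pos (by simpa using hne)]
    simp
  have hz : P.z w = z := by
    rw [PathSystem.z, hpre, List.getLastD_eq_getLast?, List.getLast?_concat]; rfl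
  exact ⟨A, B, by rw [hz, hpre], hsuf, by rw [hz, h1], h2⟩

theorem IsBad.consec {w : V} (h : P.IsBad w) : Consec (P.T w) (P.z w) (ν w) := by
  obtain ⟨A, B, -, -, h1, -⟩ := h.exists_split
  rw [h1]
  exact consec_append_cons_cons _ _

theorem IsBad.adj_z {w : V} (h : P.IsBad w) : G.Adj (P.z w) (ν w) := (P.adj _ _ _ h.consec).1

theorem IsBad.z_mem {w : V} (h : P.IsBad w) : P.z w ∈ P.T w := by
  obtain ⟨A, B, -, -, h1, -⟩ := h.exists_split
  rw [h1]; simp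

theorem IsBad.z_ne {w : V} (h : P.IsBad w) : P.z w ≠ w := by
  obtain ⟨A, B, -, -, h1, -⟩ := h.exists_split
  have hn := P.nodup w
  rw [h1] at hn
  rintro e
  rw [e] at hn
  simp at hn

theorem IsBad.z_ne_μ {w : V} (h : P.IsBad w) : P.z w ≠ P.μ w := by
  obtain ⟨A, B, -, -, h1, h2⟩ := h.exists_split
  have hn := P.nodup w
  rw [h1] at hn
  rintro e
  rw [e] at hn
  rcases h2 with rfl | ⟨a, rfl⟩ <;> simp [List.nodup_append] at hn

variable (P) in
/-- Both ends of the edge of the matching `ν` at `w` are bad. -/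
def IsBadPair (w : V) : Prop := P.IsBad w ∧ P.IsBad (ν w)

theorem IsBadPair.symm {w : V} (h : P.IsBadPair w) : P.IsBadPair (ν w) :=
  ⟨h.2, by rw [P.ν_ν]; exact h.1⟩

theorem isBadPair_ν {w : V} : P.IsBadPair (ν w) ↔ P.IsBadPair w :=
  ⟨fun h => by simpa [P.ν_ν] using h.symm, IsBadPair.symm⟩

/-- The edge that a rotation at `w` releases can be attached to the path with end `ν w`. -/
theorem IsBadPair.z_notMem_or {w : V} (h : P.IsBadPair w) :
    P.z w ∉ P.T (ν w) ∨ P.z w = P.μ (ν w) := by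
  by_contra! hcon
  obtain ⟨hz, hzμ⟩ := hcon
  have hw : w ∈ P.T (ν w) := by simpa [P.ν_ν] using h.2.1
  have hwμ : w ≠ P.μ (ν w) := by simpa [P.ν_ν] using h.2.2
  obtain ⟨A, z, B, h1, h2⟩ := P.exists_of_chord hz h.1.adj_z.symm hzμ (fun hc => by
    have h3 := P.unique _ _ _ _ (P.consec_T_μ.2 h.1.consec) hc
    exact h.1.2 h3.symm)
  obtain ⟨A', z', B', h1', h2'⟩ := P.exists_of_chord hw (P.adj_ν w).symm hwμ (fun hc => by
    exact (P.adj _ _ _ hc).2 (P.ν_ν w).symm)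
  -- both `w` and `P.z w` are next to the last vertex, so they are adjacent
  have key : G.Adj w (P.z w) := by
    have hc := P.isChain_T (ν w)
    have hne := h.1.z_ne
    rcases h2 with rfl | ⟨a, rfl⟩ <;> rcases h2' with rfl | ⟨a', rfl⟩
    · rw [h1] at h1'
      have := List.append_inj' (s₁ := ν w :: A ++ [z]) (t₁ := [P.z w, P.μ (ν w)])
        (s₂ := ν w :: A' ++ [z']) (t₂ := [w, P.μ (ν w)]) (by simpa using h1') rfl
      simp at this
      exact absurd this.2 hne
    · rw [h1] at h1' hc
      have := List.append_inj' (s₁ := ν w :: A) (t₁ := [z, P.z w, P.μ (ν w)])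
        (s₂ := ν w :: A' ++ [z']) (t₂ := [w, a', P.μ (ν w)]) (by simpa using h1') rfl
      simp at this
      have h3 := hc.right_of_append
      simp at h3
      exact this.2.1 ▸ h3.1
    · rw [h1'] at hc
      rw [h1] at h1'
      have := List.append_inj' (s₁ := ν w :: A ++ [z]) (t₁ := [P.z w, a, P.μ (ν w)])
        (s₂ := ν w :: A' ) (t₂ := [z', w, P.μ (ν w)]) (by simpa using h1') rfl
      simp at this
      rw [this.2.1]
      have h3 := hc.right_of_append
      simp at h3
      exact h3.1.symm
    · rw [h1] at h1'
      have := List.append_inj' (s₁ := ν w :: A ++ [z]) (t₁ := [P.z w, a, P.μ (ν w)])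
        (s₂ := ν w :: A' ++ [z']) (t₂ := [w, a', P.μ (ν w)]) (by simpa using h1') rfl
      simp at this
      exact absurd this.2.1 hne
  exact P.no_triangle key h.1.adj_z (P.adj_ν w).symm

/-- After a rotation at `w`, the new end can be extended along the matching `ν`. -/
theorem IsBad.ν_z_notMem_or {w : V} (h : P.IsBad w) :
    ν (P.z w) ∉ P.T w ∨ ν (P.z w) = P.μ w := by
  by_contra! hcon
  obtain ⟨hz, hzμ⟩ := hcon
  obtain ⟨A, B, -, -, h1, h2⟩ := h.exists_split
  have hl := P.length w
  have hn := P.nodup w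
  have hνz : P.z w = ν (ν (P.z w)) := (P.ν_ν _).symm
  have hmem := hz
  rw [h1] at hmem hn
  simp only [List.cons_append, List.mem_cons, List.mem_append] at hmem
  rcases hmem with e | hA | e | e | hB
  · rw [e] at hνz
    rw [← hνz] at hn
    simp [List.nodup_append] at hn
  · obtain ⟨s, t, rfl⟩ := List.append_of_mem hA
    have ht : t ≠ [] := by
      rintro rfl
      refine (P.adj w (ν (P.z w)) (P.z w) ?_).2 hνz
      rw [h1]
      exact ⟨w :: s, ν w :: B, by simp⟩
    have h3 := P.length_of_chord (w := w) (s := w :: s) (x := ν (P.z w)) (t := t) (y := P.z w)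
      (r := ν w :: B) (by rw [h1]; simp) (P.adj_ν _).symm ht
    rw [h1] at hl
    rcases h2 with rfl | ⟨a, rfl⟩ <;> simp at hl <;> omega
  · exact P.ν_ne _ e
  · rw [e, P.ν_ν] at hνz
    exact h.z_ne hνz
  · rcases h2 with rfl | ⟨a, rfl⟩
    · exact hzμ (by simpa using hB)
    · have hB' : ν (P.z w) = a := by simpa [hzμ] using hB
      have hc := P.isChain_T w
      rw [h1] at hc
      have h3 := hc.right_of_append
      simp at h3
      exact P.no_triangle h3.1 h3.2.1 (by rw [← hB']; exact (P.adj_ν _).symm)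

/-- If both ends of a path of the system are bad and they are adjacent, then the path has six
vertices, and the third one is matched to the last one. -/
theorem IsBad.z_eq_of_adj {w : V} (h : P.IsBad w) (h' : P.IsBad (P.μ w))
    (hadj : G.Adj w (P.μ w)) : P.z w = ν (P.μ w) := by
  have key : ∀ w, P.IsBad w → G.Adj w (P.μ w) →
      ∃ s a, P.T w = [w, s, P.z w, ν w, a, P.μ w] := by
    intro w h hadj
    obtain ⟨A, B, -, -, h1, h2⟩ := h.exists_split
    have hc := P.isChain_T w
    have hn := P.nodup w
    rw [h1] at hc hn
    have h3 := hc.right_of_append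
    rcases h2 with rfl | ⟨a, rfl⟩
    · simp at h3
      exact (P.no_triangle h3.2 hadj.symm (P.adj_ν w)).elim
    · simp at h3
      have hl := P.length w
      rw [h1] at hl
      have hle : 2 * k - 2 ≤ 4 := by
        have h4 := P.girth.trans (egirth_le_of_nodup
          (l := [ν w, a, P.μ w, w]) (a := ν w) (z := w) (by simp [h3, hadj.symm])
          (by simp at hn; grind) (by simp) rfl rfl (P.adj_ν w))
        exact_mod_cast h4
      have := P.three_le
      simp at hl
      obtain ⟨s, rfl⟩ := List.length_eq_one_iff.1 (show A.length = 1 by omega)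
      exact ⟨s, a, h1⟩
  obtain ⟨s, a, h1⟩ := key w h hadj
  obtain ⟨s', a', h2⟩ := key _ h' (by rw [P.μ_μ]; exact hadj.symm)
  rw [P.rev, h1] at h2
  simp at h2
  exact h2.2.2.1

/-- The path with end `w` after its rotation at `w`: the edge from `w` to `ν w` replaces the edge
from `P.z w` to `ν w`, and `P.z w` becomes an end; only used if `w` is bad. -/
noncomputable def rotation (P : PathSystem G ν k) (w : V) : List V := (P.pre w).reverse ++ P.suf w

theorem IsBad.exists_rotation {w : V} (h : P.IsBad w) :
    ∃ A B, P.T w = w :: A ++ P.z w :: ν w :: B ++ [P.μ w] ∧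
      P.rotation w = P.z w :: A.reverse ++ w :: ν w :: B ++ [P.μ w] ∧
      P.pre w = w :: A ++ [P.z w] ∧ P.suf w = ν w :: B ++ [P.μ w] := by
  obtain ⟨A, B, h1, h2, h3, h4⟩ := h.exists_split
  obtain ⟨B', rfl⟩ : ∃ B', B = B' ++ [P.μ w] := by
    rcases h4 with rfl | ⟨a, rfl⟩
    · exact ⟨[], rfl⟩
    · exact ⟨[a], rfl⟩
  refine ⟨A, B', by rw [h3]; simp, ?_, h1, by rw [h2]; simp⟩
  rw [rotation, h1, h2]
  simp

theorem rotation_perm (w : V) : (P.rotation w).Perm (P.T w) := by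
  have e : P.T w = P.pre w ++ P.suf w := (List.takeWhile_append_dropWhile ..).symm
  rw [e]
  exact (List.reverse_perm _).append_right _

end PathSystem

end

/-! ### Attaching the second matching -/

section

variable {V : Type*} {G : SimpleGraph V} {ν : V → V} {k : ℕ}

namespace PathSystem

/-- Rotating both at `w` and at `ν (μ w)` is impossible: the second rotation releases the edge from
`w` to `μ w`, which cannot be attached at the end `μ w` of the path that still contains `w` as an
inner vertex after the first one. -/
def IsClash (P : PathSystem G ν k) (S : Set V) (w : V) : Prop :=
  w ∈ S ∧ P.IsBadPair w ∧ P.IsBadPair (P.μ w) ∧ P.z (ν (P.μ w)) = w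

variable {P : PathSystem G ν k} {S : Set V}

theorem IsClash.z_eq {w : V} (h : P.IsClash S w) : P.z w = ν (P.μ w) := by
  refine h.2.1.1.z_eq_of_adj h.2.2.1.1 ?_
  have h1 := h.2.2.1.symm.1.adj_z
  rwa [h.2.2.2, P.ν_ν] at h1

end PathSystem

/-- The choices that determine how the edges of the matching `ν` are added to a path system: a set
`S` with exactly one end of each path and of each edge of the matching, and a kernel `Q` of the
set of clashes. -/
structure Selection (P : PathSystem G ν k) where
  S : Set V
  /-- At the vertices `w` of `Q` the rotation is carried out, at `ν (μ w)` it is not. -/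
  Q : Set V
  mem_S_μ : ∀ w, P.μ w ∈ S ↔ w ∉ S
  mem_S_ν : ∀ w, ν w ∈ S ↔ w ∉ S
  isClash : ∀ w ∈ Q, P.IsClash S w
  indep : ∀ w ∈ Q, ν (P.μ w) ∉ Q
  dominating : ∀ w, P.IsClash S w → w ∉ Q → ν (P.μ w) ∈ Q

theorem PathSystem.nonempty_selection [Finite V] (P : PathSystem G ν k) :
    Nonempty (Selection P) := by
  classical
  have := Fintype.ofFinite V
  obtain ⟨S, hS⟩ := exists_common_transversal P.μ ν P.μ_μ P.ν_ν P.μ_ne P.ν_ne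
  obtain ⟨Q, hQ, h1, h2⟩ := exists_kernel
    ((Function.Involutive.toPerm P.μ P.μ_μ).trans (Function.Involutive.toPerm ν P.ν_ν))
    (Finset.univ.filter (P.IsClash S)) (fun u hu h => by
      have h0 : P.IsClash S u := (Finset.mem_filter.1 (h 0)).2
      have h1 : P.IsClash S (ν (P.μ u)) := (Finset.mem_filter.1 (h 1)).2
      exact h1.z_eq.symm.trans h0.2.2.2) (fun u hu => by
      have h0 : P.IsClash S u := (Finset.mem_filter.1 hu).2
      intro e
      have e : ν (P.μ u) = u := e
      exact h0.2.1.1.2 (by rw [← e, P.ν_ν, e]))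
  exact ⟨{
    S := S
    Q := Q
    mem_S_μ := fun w => (hS w).1
    mem_S_ν := fun w => (hS w).2
    isClash := fun w hw => (Finset.mem_filter.1 (hQ hw)).2
    indep := fun w hw h => h1 w (Finset.mem_coe.1 hw) (Finset.mem_coe.1 h)
    dominating := fun w hw h => Finset.mem_coe.2
      (h2 w (Finset.mem_filter.2 ⟨Finset.mem_univ _, hw⟩) fun h' => h (Finset.mem_coe.2 h')) }⟩

namespace Selection

variable {P : PathSystem G ν k} (X : Selection P)

/-- The end `w` is the one to which the edge of the matching at `w` is attached by default. -/
def Receives (w : V) : Prop :=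
  ¬ P.IsBadPair w ∧ ¬ P.IsBad w ∧ (P.IsBad (ν w) ∨ w ∈ X.S)

/-- If both ends of the edge of the matching at `w` are bad, then one rotates at its end `w ∈ S` by
default, and the released edge extends the path with end `ν w` to `P.z w`. Rotating at `w` would
give the path with end `ν w` two extensions to the same vertex, or a second extension besides one
that already closes it to a cycle. -/
def Conflict (w : V) : Prop :=
  w ∈ X.S ∧ P.IsBadPair w ∧ X.Receives (P.μ (ν w)) ∧
    (P.z w = P.μ (ν w) ∨ P.z w = ν (P.μ (ν w)))

/-- The conflict at `w` is resolved by rotating at `ν w` instead of `w`. -/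
def Flips (w : V) : Prop :=
  X.Conflict w ∧ P.IsBadPair (P.μ w) ∧ P.z (ν (P.μ w)) = ν (P.z w)

/-- The conflict at `w` is resolved by attaching the edge of the matching at `z w` to the path that
was rotated at `w`. -/
def Steals (w : V) : Prop := X.Conflict w ∧ ¬ X.Flips w

/-- The path with end `w` is rotated at `w`, using the edge from `w` to `ν w`. -/
def Rotates (w : V) : Prop :=
  P.IsBadPair w ∧ ((w ∈ X.S ∧ P.μ (ν w) ∉ X.Q ∧ ¬ X.Flips w) ∨ (w ∉ X.S ∧ X.Flips (ν w)))

/-- `X.Extends w x` says that at its end belonging to `w`, the path with end `w` is extended to the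
vertex `x`, after the rotation if there is one. -/
inductive Extends (w : V) : V → Prop
  /-- The edge of the matching at `w`. -/
  | plain : X.Receives w → ¬ X.Steals (ν (P.μ w)) → Extends w (ν w)
  /-- The edge of the matching at `w` with two bad ends that is not used for a rotation because of a
  clash; it closes the path that is rotated at its other end `μ w`. -/
  | clash : P.μ w ∈ X.Q → Extends w (ν w)
  /-- The edge of the matching at the new end of the path that is rotated at `w`. -/
  | steal : X.Steals w → Extends w (ν (P.z w))
  /-- The released edge, if the edge of the matching at `P.z (ν w)` was taken elsewhere. -/
  | robbed : X.Steals (ν w) → Extends w (P.z (ν w))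
  /-- The released edge, without a conflict. -/
  | released : X.Rotates (ν w) → ¬ X.Steals (ν w) → Extends w (P.z (ν w))

variable {X} {w x y : V}

theorem Receives.not_ν (h : X.Receives w) : ¬ X.Receives (ν w) := by
  rintro ⟨h1, h2, h3⟩
  rw [P.ν_ν, X.mem_S_ν] at h3
  have := h.2
  tauto

theorem receives_or (h : ¬ P.IsBadPair w) : X.Receives w ∨ X.Receives (ν w) := by
  have h' := h
  unfold Receives
  rw [P.isBadPair_ν, P.ν_ν, X.mem_S_ν]
  unfold PathSystem.IsBadPair at h ⊢
  tauto

theorem Conflict.not_isBadPair_z (h : X.Conflict w) : ¬ P.IsBadPair (P.z w) := by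
  rcases h.2.2.2 with e | e <;> rw [e]
  · exact h.2.2.1.1
  · rw [P.isBadPair_ν]; exact h.2.2.1.1

theorem Conflict.z_ne (h : X.Conflict w) (h' : P.IsBadPair (P.μ w)) : P.z w ≠ ν (P.μ w) := by
  intro e
  exact h.not_isBadPair_z (by rw [e, P.isBadPair_ν]; exact h')

theorem Conflict.notMem (h : X.Conflict w) : P.μ (ν w) ∉ X.Q :=
  fun hq => h.2.2.1.1 (X.isClash _ hq).2.1

theorem not_conflict_of_isClash (h : P.IsClash X.S w) : ¬ X.Conflict w :=
  fun hc => hc.z_ne h.2.2.1 h.z_eq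

theorem Steals.rotates (h : X.Steals w) : X.Rotates w :=
  ⟨h.1.2.1, Or.inl ⟨h.1.1, h.1.notMem, h.2⟩⟩

theorem Steals.mem (h : X.Steals w) : w ∈ X.S := h.1.1

theorem Rotates.not_ν (h : X.Rotates w) : ¬ X.Rotates (ν w) := by
  rintro ⟨h1, h2⟩
  rw [P.ν_ν, X.mem_S_ν] at h2
  have := h.2
  tauto

theorem Rotates.not_μ (h : X.Rotates w) : ¬ X.Rotates (P.μ w) := by
  rintro ⟨h1, h2⟩
  rw [X.mem_S_μ] at h2
  rcases h.2 with h3 | h3 <;> rcases h2 with h2 | h2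
  · exact h2.1 h3.1
  · have := h2.2.1.2.2.1.1
    rw [P.ν_ν, P.μ_μ] at this
    exact this h.1
  · have := h3.2.1.2.2.1.1
    rw [P.ν_ν] at this
    exact this h1
  · exact h2.1 h3.1

theorem mem_S_of_mem_Q (h : w ∈ X.Q) : w ∈ X.S := (X.isClash w h).1

theorem not_rotates_of_mem_Q (h : P.μ (ν w) ∈ X.Q) : ¬ X.Rotates w := by
  rintro ⟨h1, h2⟩
  have := mem_S_of_mem_Q h
  rw [X.mem_S_μ, X.mem_S_ν] at this
  tauto

theorem rotates_of_mem_Q (h : w ∈ X.Q) : X.Rotates w := by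
  refine ⟨(X.isClash w h).2.1, Or.inl ⟨mem_S_of_mem_Q h, fun h' => ?_, fun h' =>
    not_conflict_of_isClash (X.isClash w h) h'.1⟩⟩
  have := X.indep _ h'
  rw [P.μ_μ, P.ν_ν] at this
  exact this h

theorem not_steals_of_mem_Q (h : w ∈ X.Q) : ¬ X.Steals w :=
  fun h' => not_conflict_of_isClash (X.isClash w h) h'.1

theorem isBadPair_of_mem_Q (h : P.μ w ∈ X.Q) : P.IsBadPair w := by
  have := (X.isClash _ h).2.2.1
  rwa [P.μ_μ] at this

theorem not_isBadPair_or_of_extends (h : X.Extends w x) :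
    (X.Receives w ∧ ¬ X.Steals (ν (P.μ w)) ∧ x = ν w) ∨ P.IsBadPair w := by
  rcases h with ⟨h1, h2⟩ | h1 | h1 | h1 | ⟨h1, h2⟩
  · exact Or.inl ⟨h1, h2, rfl⟩
  · exact Or.inr (isBadPair_of_mem_Q h1)
  · exact Or.inr h1.1.2.1
  · exact Or.inr (P.isBadPair_ν.1 h1.1.2.1)
  · exact Or.inr (P.isBadPair_ν.1 h1.1)

theorem Receives.not_rotates (h : X.Receives w) : ¬ X.Rotates w := fun h' => h.1 h'.1

theorem Receives.not_rotates_ν (h : X.Receives w) : ¬ X.Rotates (ν w) :=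
  fun h' => h.1 (P.isBadPair_ν.1 h'.1)

theorem Receives.not_extends_ν (h : X.Receives w) : ¬ X.Extends (ν w) x := by
  intro h'
  rcases not_isBadPair_or_of_extends h' with h1 | h1
  · exact h.not_ν h1.1
  · exact h.1 (P.isBadPair_ν.1 h1)

theorem Steals.not_extends (h : X.Steals w) : ¬ X.Extends (P.μ (ν w)) x := by
  intro h'
  rcases not_isBadPair_or_of_extends h' with h1 | h1
  · have := h1.2.1
    rw [P.μ_μ, P.ν_ν] at this
    exact this h
  · exact h.1.2.2.1.1 h1

theorem Steals.not_extends_z (h : X.Steals w) : ¬ X.Extends (P.z w) x := by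
  rcases h.1.2.2.2 with e | e <;> rw [e]
  · exact h.not_extends
  · exact h.1.2.2.1.not_extends_ν

theorem Steals.not_extends_ν_z (h : X.Steals w) : ¬ X.Extends (ν (P.z w)) x := by
  rcases h.1.2.2.2 with e | e <;> rw [e]
  · exact h.1.2.2.1.not_extends_ν
  · rw [P.ν_ν]; exact h.not_extends

theorem Steals.not_rotates_z (h : X.Steals w) : ¬ X.Rotates (P.z w) :=
  fun h' => h.1.not_isBadPair_z h'.1

theorem Steals.not_rotates_ν_z (h : X.Steals w) : ¬ X.Rotates (ν (P.z w)) :=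
  fun h' => h.1.not_isBadPair_z (P.isBadPair_ν.1 h'.1)

/-- Two thefts concern different edges of the matching. -/
theorem Steals.eq_of_z {u : V} (h : X.Steals w) (h' : X.Steals u)
    (e : P.z u = P.z w ∨ P.z u = ν (P.z w)) : u = w := by
  have h1 := h.1.2.2.1
  have h2 := h'.1.2.2.1
  have key : P.μ (ν u) = P.μ (ν w) ∨ P.μ (ν u) = ν (P.μ (ν w)) := by
    have hν := P.ν_ν
    rcases h.1.2.2.2 with e1 | e1 <;> rcases h'.1.2.2.2 with e2 | e2 <;> rw [e1, e2] at e <;>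
      grind
  have key : P.μ (ν u) = P.μ (ν w) := by
    rcases key with e | e
    · exact e
    · rw [e] at h2; exact (h1.not_ν h2).elim
  rw [← P.ν_ν u, ← P.μ_μ (ν u), key, P.μ_μ, P.ν_ν]

/-- If the edge released by the rotation at `a` closes the path with end `ν a`, then this path is
neither rotated nor extended at its other end. -/
theorem Rotates.not_extends_of_z_eq {a : V} (h : X.Rotates a) (e : P.z a = P.μ (ν a)) :
    ¬ X.Rotates (P.μ (ν a)) ∧ ∀ y, ¬ X.Extends (P.μ (ν a)) y := by
  by_cases hp : P.IsBadPair (P.μ (ν a))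
  · rcases h.2 with ⟨h1, h2, h3⟩ | ⟨h1, h2⟩
    · have hcl : P.IsClash X.S (P.μ (ν a)) := by
        refine ⟨by rw [X.mem_S_μ, X.mem_S_ν]; simpa using h1, hp, ?_, ?_⟩
        · rw [P.μ_μ]; exact h.1.symm
        · rw [P.μ_μ, P.ν_ν, e]
      have ha : a ∈ X.Q := by
        have := X.dominating _ hcl h2
        rwa [P.μ_μ, P.ν_ν] at this
      have haa : P.μ (ν a) = ν (P.μ a) := by rw [← e, (X.isClash a ha).z_eq]
      have hp' : P.μ (ν (P.μ (ν a))) ∈ X.Q := by rwa [haa, P.ν_ν, P.μ_μ]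
      have hr := not_rotates_of_mem_Q hp'
      refine ⟨hr, fun y hy => ?_⟩
      have hS := hcl.1
      rcases hy with ⟨h4, h5⟩ | h4 | h4 | h4 | ⟨h4, h5⟩
      · exact h4.1 hp
      · exact (X.mem_S_μ _).1 (mem_S_of_mem_Q h4) hS
      · exact hr h4.rotates
      · exact (X.mem_S_ν _).1 h4.mem hS
      · rcases h4.2 with h6 | h6
        · exact (X.mem_S_ν _).1 h6.1 hS
        · rw [P.ν_ν] at h6
          exact h6.2.1.notMem hp'
    · -- the conflict at `ν a` would concern a bad edge
      refine (h2.1.z_ne h2.2.1 ?_).elim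
      refine h2.1.2.1.1.z_eq_of_adj hp.1 ?_
      have := h.1.1.adj_z
      rw [e] at this
      exact this.symm
  · refine ⟨fun h' => hp h'.1, fun y hy => ?_⟩
    rcases not_isBadPair_or_of_extends hy with h1 | h1
    · rw [P.μ_μ, P.ν_ν] at h1
      rcases h.2 with ⟨h2, h3, h4⟩ | ⟨h2, h3⟩
      · exact h1.2.1 ⟨⟨h2, h.1, h1.1, Or.inl e⟩, h4⟩
      · exact hp h3.2.1
    · exact hp h1

open Classical in
variable (X) in
/-- The end of the path with end `w` that belongs to `w`, after the rotation. -/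
noncomputable def newEnd (w : V) : V := if X.Rotates w then P.z w else w

theorem Rotates.newEnd (h : X.Rotates w) : X.newEnd w = P.z w := if_pos h

theorem newEnd_of_not (h : ¬ X.Rotates w) : X.newEnd w = w := if_neg h

/-- An extension leads to a new vertex, or it closes the path to a cycle. -/
theorem Extends.notMem_or (h : X.Extends w x) :
    x ∉ P.T w ∨ (x = X.newEnd (P.μ w) ∧ ∀ y, ¬ X.Extends (P.μ w) y) := by
  rcases h with ⟨h1, h2⟩ | h1 | h1 | h1 | ⟨h1, h2⟩
  · by_cases hν : ν w ∈ P.T w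
    · have e : ν w = P.μ w := by
        by_contra hne
        exact h1.2.1 ⟨hν, hne⟩
      rw [← e]
      exact Or.inr ⟨(newEnd_of_not h1.not_rotates_ν).symm, fun y => h1.not_extends_ν⟩
    · exact Or.inl hν
  · have hr := rotates_of_mem_Q h1
    have hz := (X.isClash _ h1).z_eq
    rw [P.μ_μ] at hz
    refine Or.inr ⟨by rw [hr.newEnd, hz], fun y hy => ?_⟩
    have hS := mem_S_of_mem_Q h1
    rcases hy with ⟨h4, h5⟩ | h4 | h4 | h4 | ⟨h4, h5⟩
    · exact h4.1 hr.1
    · exact (X.mem_S_μ _).1 (mem_S_of_mem_Q h4) hS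
    · exact not_steals_of_mem_Q h1 h4
    · exact (X.mem_S_ν _).1 h4.mem hS
    · exact hr.not_ν h4
  · rcases h1.1.2.1.1.ν_z_notMem_or with h2 | h2
    · exact Or.inl h2
    · refine Or.inr ⟨?_, fun y => ?_⟩
      · rw [h2, newEnd_of_not h1.rotates.not_μ]
      · rw [← h2]; exact h1.not_extends_ν_z
  all_goals
    have hr : X.Rotates (ν w) := by first | exact h1.rotates | exact h1
    rcases hr.1.z_notMem_or with h3 | h3
    · rw [P.ν_ν] at h3; exact Or.inl h3
    · have h4 := hr.not_extends_of_z_eq h3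
      rw [P.ν_ν] at h3 h4
      exact Or.inr ⟨by rw [newEnd_of_not h4.1, h3], h4.2⟩

/-- The two ends of a path are not extended to the same vertex, by cases on the types of the two
extensions, of which only some occur at `w ∈ X.S`. -/
theorem not_extends_μ_of_mem (hw : w ∈ X.S) (h : X.Extends w x) : ¬ X.Extends (P.μ w) x := by
  intro h'
  have hw' : P.μ w ∉ X.S := fun h1 => (X.mem_S_μ w).1 h1 hw
  have hwν : ν w ∉ X.S := fun h1 => (X.mem_S_ν w).1 h1 hw
  -- the extensions at `w ∈ X.S`
  have h1 : (X.Receives w ∧ ¬ X.Steals (ν (P.μ w)) ∧ x = ν w) ∨ (X.Steals w ∧ x = ν (P.z w)) ∨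
      (X.Flips w ∧ x = P.z (ν w)) := by
    rcases h with ⟨h1, h2⟩ | h1 | h1 | h1 | ⟨h1, h2⟩
    · exact Or.inl ⟨h1, h2, rfl⟩
    · exact (hw' (mem_S_of_mem_Q h1)).elim
    · exact Or.inr (Or.inl ⟨h1, rfl⟩)
    · exact (hwν h1.mem).elim
    · rcases h1.2 with h3 | h3
      · exact (hwν h3.1).elim
      · rw [P.ν_ν] at h3
        exact Or.inr (Or.inr ⟨h3.2, rfl⟩)
  -- the extensions at `μ w ∉ X.S`
  have h2 : (X.Receives (P.μ w) ∧ x = ν (P.μ w)) ∨ (w ∈ X.Q ∧ P.IsBadPair (P.μ w)) ∨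
      (X.Rotates (ν (P.μ w)) ∧ x = P.z (ν (P.μ w))) := by
    clear h1
    rcases h' with ⟨h1, h2⟩ | h1 | h1 | h1 | ⟨h1, h2⟩
    · exact Or.inl ⟨h1, rfl⟩
    · rw [P.μ_μ] at h1
      exact Or.inr (Or.inl ⟨h1, (X.isClash w h1).2.2.1⟩)
    · exact (hw' h1.mem).elim
    · exact Or.inr (Or.inr ⟨h1.rotates, rfl⟩)
    · exact Or.inr (Or.inr ⟨h1, rfl⟩)
  rcases h1 with ⟨h1, h3, rfl⟩ | ⟨h1, rfl⟩ | ⟨h1, rfl⟩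
  · rcases h2 with ⟨h2, e⟩ | ⟨h2, -⟩ | ⟨h2, e⟩
    · exact P.μ_ne w (by rw [← P.ν_ν (P.μ w), ← e, P.ν_ν])
    · exact h1.1 (X.isClash w h2).2.1
    · apply h3
      rcases h2.2 with h4 | h4
      · refine ⟨⟨h4.1, h2.1, ?_, Or.inr ?_⟩, h4.2.2⟩
        · rw [P.ν_ν, P.μ_μ]; exact h1
        · rw [P.ν_ν, P.μ_μ]; exact e.symm
      · exact (h4.1 ((X.mem_S_ν _).2 hw')).elim
  · rcases h2 with ⟨h2, e⟩ | ⟨h2, -⟩ | ⟨h2, e⟩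
    · apply h1.1.2.1.1.z_ne_μ
      rw [← P.ν_ν (P.z w), e, P.ν_ν]
    · exact not_steals_of_mem_Q h2 h1
    · exact h1.2 ⟨h1.1, P.isBadPair_ν.1 h2.1, e.symm⟩
  · rcases h2 with ⟨h2, e⟩ | ⟨h2, -⟩ | ⟨h2, e⟩
    · exact h2.1 h1.2.1
    · exact not_conflict_of_isClash (X.isClash w h2) h1.1
    · -- `z (ν w)` would be matched to `z w`
      have e' : P.z (ν w) = ν (P.z w) := e.trans h1.2.2
      have hb := h1.1.2.1.symm.1
      rcases h1.1.2.2.2 with h3 | h3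
      · have hR := h1.1.2.2.1
        apply hR.2.1
        rw [← h3, PathSystem.IsBad, ← e']
        rw [h3, P.mem_T_μ, P.μ_μ]
        refine ⟨hb.z_mem, hb.z_ne⟩
      · rw [h3, P.ν_ν] at e'
        exact hb.z_ne_μ e'

theorem Extends.not_μ (h : X.Extends w x) : ¬ X.Extends (P.μ w) x := by
  by_cases hw : w ∈ X.S
  · exact not_extends_μ_of_mem hw h
  · intro h'
    refine not_extends_μ_of_mem ((X.mem_S_μ w).2 hw) h' ?_
    rwa [P.μ_μ]

/-- Except for released edges without a theft, an extension leads to a vertex that keeps its own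
path end: that path is neither rotated nor, by `Extends.not_extends`, extended there. -/
theorem Extends.not_rotates (h : X.Extends w x)
    (h' : X.Rotates (ν w) → X.Steals (ν w)) : ¬ X.Rotates x := by
  rcases h with ⟨h1, h2⟩ | h1 | h1 | h1 | ⟨h1, h2⟩
  · exact h1.not_rotates_ν
  · exact not_rotates_of_mem_Q (by rwa [P.ν_ν])
  · exact h1.not_rotates_ν_z
  · exact h1.not_rotates_z
  · exact (h2 (h' h1)).elim

theorem Extends.not_extends (h : X.Extends w x)
    (h' : X.Rotates (ν w) → X.Steals (ν w)) : ¬ X.Extends x y := by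
  rcases h with ⟨h1, h2⟩ | h1 | h1 | h1 | ⟨h1, h2⟩
  · exact h1.not_extends_ν
  · have hb := (isBadPair_of_mem_Q h1).symm
    have hS : ν w ∈ X.S := by
      rw [X.mem_S_ν, ← X.mem_S_μ]; exact mem_S_of_mem_Q h1
    intro hy
    rcases hy with ⟨h4, h5⟩ | h4 | h4 | h4 | ⟨h4, h5⟩
    · exact h4.1 hb
    · exact (X.mem_S_μ _).1 (mem_S_of_mem_Q h4) hS
    · exact not_rotates_of_mem_Q (by rwa [P.ν_ν]) h4.rotates
    · exact (X.mem_S_ν _).1 h4.mem hS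
    · rcases h4.2 with h6 | h6
      · exact (X.mem_S_ν _).1 h6.1 hS
      · rw [P.ν_ν] at h6
        exact h6.2.1.notMem (by rwa [P.ν_ν])
  · exact h1.not_extends_ν_z
  · exact h1.not_extends_z
  · exact (h2 (h' h1)).elim

/-- Two extensions to the same vertex that both do not come from a released edge without a theft are
equal. -/
theorem eq_of_extends {u : V} (h : X.Extends w x) (h' : X.Rotates (ν w) → X.Steals (ν w))
    (k : X.Extends u x) (k' : X.Rotates (ν u) → X.Steals (ν u)) : w = u := by
  -- an extension along an edge of the matching contradicts a theft of this edge
  have key : ∀ {w u : V}, X.Extends w (ν w) → X.Steals u →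
      (ν w = P.z u ∨ ν w = ν (P.z u)) → False := by
    intro w u hw hu e
    rcases e with e | e
    · have : w = ν (P.z u) := by rw [← e, P.ν_ν]
      exact hu.not_extends_ν_z (this ▸ hw)
    · have : w = P.z u := by rw [← P.ν_ν w, e, P.ν_ν]
      exact hu.not_extends_z (this ▸ hw)
  have hν : Function.Injective ν := fun a b hab => by rw [← P.ν_ν a, hab, P.ν_ν]
  have h1 : (X.Extends w (ν w) ∧ x = ν w) ∨ (X.Steals w ∧ x = ν (P.z w)) ∨
      (X.Steals (ν w) ∧ x = P.z (ν w)) := by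
    rcases h with ⟨h1, h2⟩ | h1 | h1 | h1 | ⟨h1, h2⟩
    · exact Or.inl ⟨.plain h1 h2, rfl⟩
    · exact Or.inl ⟨.clash h1, rfl⟩
    · exact Or.inr (Or.inl ⟨h1, rfl⟩)
    · exact Or.inr (Or.inr ⟨h1, rfl⟩)
    · exact (h2 (h' h1)).elim
  have k1 : (X.Extends u (ν u) ∧ x = ν u) ∨ (X.Steals u ∧ x = ν (P.z u)) ∨
      (X.Steals (ν u) ∧ x = P.z (ν u)) := by
    clear h1
    rcases k with ⟨h1, h2⟩ | h1 | h1 | h1 | ⟨h1, h2⟩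
    · exact Or.inl ⟨.plain h1 h2, rfl⟩
    · exact Or.inl ⟨.clash h1, rfl⟩
    · exact Or.inr (Or.inl ⟨h1, rfl⟩)
    · exact Or.inr (Or.inr ⟨h1, rfl⟩)
    · exact (h2 (k' h1)).elim
  rcases h1 with ⟨h1, rfl⟩ | ⟨h1, rfl⟩ | ⟨h1, rfl⟩ <;>
    rcases k1 with ⟨k1, e⟩ | ⟨k1, e⟩ | ⟨k1, e⟩
  · exact hν e
  · exact (key h1 k1 (Or.inr e)).elim
  · exact (key h1 k1 (Or.inl e)).elim
  · exact (key k1 h1 (Or.inr e.symm)).elim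
  · exact k1.eq_of_z h1 (Or.inl (hν e))
  · have e1 := h1.eq_of_z k1 (Or.inr e.symm)
    rw [← e1] at e
    exact (P.ν_ne _ e).elim
  · exact (key k1 h1 (Or.inl e.symm)).elim
  · have e1 := k1.eq_of_z h1 (Or.inr e)
    rw [← e1] at e
    exact (P.ν_ne _ e.symm).elim
  · exact hν (h1.eq_of_z k1 (Or.inl e.symm)).symm

/-- At each vertex, at least as many paths end without an extension as with one: the released edge
at `w` is made up for by the new end at `ν w`, all other extensions by the end of the path that
begins where they lead to. -/
theorem exists_injOn_extends (v : V) : ∃ φ : V → V, Set.InjOn φ {w | X.Extends w v} ∧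
    ∀ w, X.Extends w v → X.newEnd (φ w) = v ∧ ∀ y, ¬ X.Extends (φ w) y := by
  classical
  have hν : Function.Injective ν := fun a b hab => by rw [← P.ν_ν a, hab, P.ν_ν]
  refine ⟨fun w => if X.Rotates (ν w) → X.Steals (ν w) then v else ν w, ?_, ?_⟩
  · intro w hw u hu e
    simp only at e
    split_ifs at e with h1 h2 h2
    · exact eq_of_extends hw h1 hu h2
    · rw [Classical.not_imp] at h2
      exact (Extends.not_rotates hw h1 (e ▸ h2.1)).elim
    · rw [Classical.not_imp] at h1
      exact (Extends.not_rotates hu h2 (e ▸ h1.1)).elim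
    · exact hν e
  · intro w hw
    simp only
    split_ifs with h1
    · exact ⟨newEnd_of_not (hw.not_rotates h1), fun y => hw.not_extends h1⟩
    · rw [Classical.not_imp] at h1
      obtain ⟨h1, h2⟩ := h1
      have hx : v = P.z (ν w) := by
        rcases hw with ⟨h3, h4⟩ | h3 | h3 | h3 | ⟨h3, h4⟩
        · exact (h3.not_rotates_ν h1).elim
        · exact (not_rotates_of_mem_Q (by rwa [P.ν_ν]) h1).elim
        · exact (h3.rotates.not_ν h1).elim
        · rfl
        · rfl
      refine ⟨by rw [h1.newEnd, hx], fun y hy => ?_⟩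
      rcases hy with ⟨h4, h5⟩ | h4 | h4 | h4 | ⟨h4, h5⟩
      · exact h4.not_rotates h1
      · exact h1.not_μ (rotates_of_mem_Q h4)
      · exact h2 h4
      · rw [P.ν_ν] at h4
        exact h4.rotates.not_ν h1
      · exact h1.not_ν h4

end Selection

end

/-! ### Trail systems -/

section

variable {V : Type*} {G : SimpleGraph V} {ν : V → V} {k : ℕ}

/-- A decomposition of `G` into trails that arise from paths with `2 * k` vertices by adding at
most one edge at each end. The trails are given as lists of vertices, in both directions: `F w` and
`F (μ w)` describe the same trail, beginning at different ends, and `IsExt w` says that an edge was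
added at the beginning of `F w`. -/
structure TrailSystem (G : SimpleGraph V) (k : ℕ) where
  μ : V → V
  F : V → List V
  IsExt : V → Prop
  μ_μ : ∀ w, μ (μ w) = w
  μ_ne : ∀ w, μ w ≠ w
  rev : ∀ w, F (μ w) = (F w).reverse
  length_F : ∀ w (b b' : Bool), (b = true ↔ IsExt w) → (b' = true ↔ IsExt (μ w)) →
    (F w).length = 2 * k + b.toNat + b'.toNat
  shape : ∀ w, (F w).Nodup ∨
    ((IsExt w ↔ ¬ IsExt (μ w)) ∧ ∃ z m, F w = z :: m ++ [z] ∧ (z :: m).Nodup)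
  cover : ∀ a b, G.Adj a b → ∃ w, Consec (F w) a b
  balanced : ∀ v, {w | IsExt w ∧ (F w).head? = some v}.ncard ≤
    {w | ¬ IsExt w ∧ (F w).head? = some v}.ncard

namespace Selection

variable {P : PathSystem G ν k} {X : Selection P} {w x y : V}

theorem Extends.unique (h : X.Extends w x) (h' : X.Extends w y) : x = y := by
  have key : ∀ {x}, X.Extends w x → (X.Receives w ∧ x = ν w) ∨ (P.μ w ∈ X.Q ∧ x = ν w) ∨
      (X.Steals w ∧ x = ν (P.z w)) ∨ (X.Rotates (ν w) ∧ x = P.z (ν w)) := by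
    rintro x (⟨h1, h2⟩ | h1 | h1 | h1 | ⟨h1, h2⟩)
    · exact Or.inl ⟨h1, rfl⟩
    · exact Or.inr (Or.inl ⟨h1, rfl⟩)
    · exact Or.inr (Or.inr (Or.inl ⟨h1, rfl⟩))
    · exact Or.inr (Or.inr (Or.inr ⟨h1.rotates, rfl⟩))
    · exact Or.inr (Or.inr (Or.inr ⟨h1, rfl⟩))
  have hAC : X.Receives w → ¬ X.Steals w := fun h1 h2 => h1.not_rotates h2.rotates
  have hAD : X.Receives w → ¬ X.Rotates (ν w) := fun h1 => h1.not_rotates_ν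
  have hBC : P.μ w ∈ X.Q → ¬ X.Steals w :=
    fun h1 h2 => (X.mem_S_μ w).1 (mem_S_of_mem_Q h1) h2.mem
  have hBD : P.μ w ∈ X.Q → ¬ X.Rotates (ν w) :=
    fun h1 => not_rotates_of_mem_Q (by rwa [P.ν_ν])
  have hCD : X.Steals w → ¬ X.Rotates (ν w) := fun h1 => h1.rotates.not_ν
  have h1 := key h
  have h2 := key h'
  grind

variable (X)

open Classical in
/-- The path with end `w`, rotated if `X` says so. -/
noncomputable def core (w : V) : List V :=
  if X.Rotates w then P.rotation w else if X.Rotates (P.μ w) then (P.rotation (P.μ w)).reverse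
  else P.T w

open Classical in
/-- The vertex to which the path with end `w` is extended at this end, if there is one. -/
noncomputable def ext (w : V) : Option V := if h : ∃ x, X.Extends w x then some h.choose else none

/-- The path with end `w`, after rotation and extension. -/
noncomputable def trail (w : V) : List V :=
  (X.ext w).toList ++ X.core w ++ (X.ext (P.μ w)).toList

variable {X}

theorem ext_eq_some : X.ext w = some x ↔ X.Extends w x := by
  classical
  unfold ext
  split_ifs with h
  · rw [Option.some_inj]
    exact ⟨fun e => e ▸ h.choose_spec, fun h' => h.choose_spec.unique h'⟩
  · simpa using fun h' => h ⟨x, h'⟩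

theorem ext_eq_none : X.ext w = none ↔ ∀ x, ¬ X.Extends w x := by
  rw [Option.eq_none_iff_forall_ne_some]
  simp [ext_eq_some]

theorem core_of_rotates (h : X.Rotates w) : X.core w = P.rotation w := if_pos h

theorem core_of_not (h : ¬ X.Rotates w) (h' : ¬ X.Rotates (P.μ w)) : X.core w = P.T w := by
  rw [core, if_neg h, if_neg h']

theorem core_μ (w : V) : X.core (P.μ w) = (X.core w).reverse := by
  by_cases h : X.Rotates w
  · rw [core_of_rotates h, core, if_neg h.not_μ, if_pos (by rwa [P.μ_μ]), P.μ_μ]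
  · by_cases h' : X.Rotates (P.μ w)
    · rw [core_of_rotates h', core, if_neg h, if_pos h', List.reverse_reverse]
    · rw [core_of_not h h', core_of_not h' (by rwa [P.μ_μ]), P.rev]

theorem trail_μ (w : V) : X.trail (P.μ w) = (X.trail w).reverse := by
  have h : ∀ o : Option V, o.toList.reverse = o.toList := by rintro (_ | x) <;> rfl
  simp [trail, core_μ, P.μ_μ, h]

theorem core_perm (w : V) : (X.core w).Perm (P.T w) := by
  unfold core
  split_ifs
  · exact P.rotation_perm w
  · have h' := P.rotation_perm (P.μ w)
    rw [P.rev] at h'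
    exact (List.reverse_perm _).trans (h'.trans (List.reverse_perm _))
  · exact List.Perm.refl _

theorem head?_core (w : V) : (X.core w).head? = some (X.newEnd w) := by
  by_cases h : X.Rotates w
  · rw [core_of_rotates h, h.newEnd]
    obtain ⟨A, B, -, h1, -⟩ := h.1.1.exists_rotation
    rw [h1]; rfl
  · rw [newEnd_of_not h]
    by_cases h' : X.Rotates (P.μ w)
    · rw [core, if_neg h, if_pos h']
      obtain ⟨A, B, -, h1, -⟩ := h'.1.1.exists_rotation
      rw [h1]; simp [P.μ_μ]
    · rw [core_of_not h h', P.head]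

theorem getLast?_core (w : V) : (X.core w).getLast? = some (X.newEnd (P.μ w)) := by
  rw [← head?_core, core_μ, List.head?_reverse]

theorem consec_trail_of_core {a b : V} (h : Consec (X.core w) a b) : Consec (X.trail w) a b :=
  (h.append_left _).append_right _

theorem consec_trail_of_extends (h : X.Extends w x) : Consec (X.trail w) x (X.newEnd w) := by
  obtain ⟨t, ht⟩ := List.head?_eq_some_iff.1 (head?_core (X := X) w)
  rw [trail, ext_eq_some.2 h, ht]
  exact Consec.head

theorem exists_consec_trail_swap {a b : V} (h : ∃ w, Consec (X.trail w) a b) :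
    ∃ w, Consec (X.trail w) b a := by
  obtain ⟨w, h⟩ := h
  exact ⟨P.μ w, by rw [trail_μ]; exact h.reverse⟩

theorem exists_consec_trail_of_rotates {a b : V} (hr : X.Rotates w) (h : Consec (P.T w) a b) :
    ∃ w, Consec (X.trail w) a b := by
  obtain ⟨A, B, -, -, hp, hs⟩ := hr.1.1.exists_rotation
  have e : P.T w = P.pre w ++ P.suf w := (List.takeWhile_append_dropWhile ..).symm
  rw [e] at h
  rcases h.of_append with h | h | ⟨s, t, h1, h2⟩
  · apply exists_consec_trail_swap
    refine ⟨w, consec_trail_of_core ?_⟩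
    rw [core_of_rotates hr]
    exact h.reverse.append_right _
  · refine ⟨w, consec_trail_of_core ?_⟩
    rw [core_of_rotates hr]
    exact h.append_left _
  · -- the released edge
    rw [hp] at h1
    rw [hs] at h2
    have ha : P.z w = a := by simpa using (List.append_inj' h1 rfl).2
    have hb : ν w = b := by simp at h2; exact h2.1
    subst ha hb
    have hx : X.Extends (ν w) (P.z w) := by
      by_cases hst : X.Steals w
      · have := Extends.robbed (X := X) (w := ν w) (by rwa [P.ν_ν])
        rwa [P.ν_ν] at this
      · have := Extends.released (X := X) (w := ν w) (by rwa [P.ν_ν]) (by rwa [P.ν_ν])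
        rwa [P.ν_ν] at this
    have := consec_trail_of_extends hx
    rw [newEnd_of_not hr.not_ν] at this
    exact ⟨_, this⟩

theorem exists_consec_trail_of_T {a b : V} (h : Consec (P.T w) a b) :
    ∃ w, Consec (X.trail w) a b := by
  by_cases hr : X.Rotates w
  · exact exists_consec_trail_of_rotates hr h
  · by_cases hr' : X.Rotates (P.μ w)
    · exact exists_consec_trail_swap
        (exists_consec_trail_of_rotates hr' (P.consec_T_μ.2 h))
    · exact ⟨w, consec_trail_of_core (by rwa [core_of_not hr hr'])⟩

theorem exists_consec_trail_of_rotates_ν (hr : X.Rotates w) :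
    ∃ u, Consec (X.trail u) w (ν w) := by
  obtain ⟨A, B, -, h1, -⟩ := hr.1.1.exists_rotation
  refine ⟨w, consec_trail_of_core ?_⟩
  rw [core_of_rotates hr, h1]
  exact ⟨P.z w :: A.reverse, B ++ [P.μ w], by simp⟩

theorem exists_consec_trail_of_mem (h : P.IsBadPair w) (hw : w ∈ X.S) :
    ∃ u, Consec (X.trail u) w (ν w) := by
  by_cases hr : X.Rotates w
  · exact exists_consec_trail_of_rotates_ν hr
  · by_cases hr' : X.Rotates (ν w)
    · have := exists_consec_trail_swap (exists_consec_trail_of_rotates_ν hr')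
      rwa [P.ν_ν] at this
    · have hQ : P.μ (ν w) ∈ X.Q := by
        by_contra hQ
        by_cases hf : X.Flips w
        · exact hr' ⟨h.symm, Or.inr ⟨by rw [X.mem_S_ν]; simpa using hw, by rwa [P.ν_ν]⟩⟩
        · exact hr ⟨h, Or.inl ⟨hw, hQ, hf⟩⟩
      have := consec_trail_of_extends (Extends.clash (X := X) hQ)
      rw [newEnd_of_not hr', P.ν_ν] at this
      exact ⟨_, this⟩

theorem exists_consec_trail_of_receives (h : X.Receives w) :
    ∃ u, Consec (X.trail u) w (ν w) := by
  by_cases hs : X.Steals (ν (P.μ w))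
  · have h1 := consec_trail_of_extends (Extends.steal hs)
    rw [hs.rotates.newEnd] at h1
    rcases hs.1.2.2.2 with e | e <;> rw [P.ν_ν, P.μ_μ] at e <;> rw [e] at h1
    · exact exists_consec_trail_swap ⟨_, h1⟩
    · rw [P.ν_ν] at h1; exact ⟨_, h1⟩
  · have h1 := consec_trail_of_extends (Extends.plain h hs)
    rw [newEnd_of_not h.not_rotates] at h1
    exact exists_consec_trail_swap ⟨_, h1⟩

theorem exists_consec_trail_ν (w : V) : ∃ u, Consec (X.trail u) w (ν w) := by
  have hsw : (∃ u, Consec (X.trail u) (ν w) (ν (ν w))) → ∃ u, Consec (X.trail u) w (ν w) :=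
    fun h => by rw [P.ν_ν] at h; exact exists_consec_trail_swap h
  by_cases h : P.IsBadPair w
  · by_cases hw : w ∈ X.S
    · exact exists_consec_trail_of_mem h hw
    · exact hsw (exists_consec_trail_of_mem h.symm ((X.mem_S_ν w).2 hw))
  · rcases receives_or (X := X) h with h1 | h1
    · exact exists_consec_trail_of_receives h1
    · exact hsw (exists_consec_trail_of_receives h1)

theorem head?_trail_of_extends (h : X.Extends w x) : (X.trail w).head? = some x := by
  rw [trail, ext_eq_some.2 h]; rfl

theorem head?_trail_of_not (h : ∀ x, ¬ X.Extends w x) :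
    (X.trail w).head? = some (X.newEnd w) := by
  obtain ⟨t, ht⟩ := List.head?_eq_some_iff.1 (head?_core (X := X) w)
  rw [trail, ext_eq_none.2 h, ht]; rfl

/-- A trail that is extended at `w` is a path, or it is closed and not extended at the other end. -/
theorem nodup_trail_of_extends (h : X.Extends w x) : (X.trail w).Nodup ∨
    ((∀ y, ¬ X.Extends (P.μ w) y) ∧ ∃ z m, X.trail w = z :: m ++ [z] ∧ (z :: m).Nodup) := by
  have hn : (X.core w).Nodup := (core_perm w).nodup_iff.2 (P.nodup w)
  have hmem : ∀ y, y ∈ X.core w ↔ y ∈ P.T w := fun y => (core_perm w).mem_iff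
  rcases h.notMem_or with h1 | ⟨h1, h2⟩
  · by_cases h' : ∃ y, X.Extends (P.μ w) y
    · obtain ⟨y, hy⟩ := h'
      have hxy : x ≠ y := fun e => h.not_μ (e ▸ hy)
      rcases hy.notMem_or with h2 | ⟨-, h2⟩
      · rw [P.mem_T_μ] at h2
        refine Or.inl ?_
        rw [trail, ext_eq_some.2 h, ext_eq_some.2 hy]
        simp only [Option.toList_some, List.nil_append, List.cons_append]
        rw [List.nodup_cons]
        refine ⟨by simp [hmem, h1, hxy], ?_⟩
        rw [(List.perm_append_singleton y _).nodup_iff, List.nodup_cons, hmem]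
        exact ⟨h2, hn⟩
      · rw [P.μ_μ] at h2
        exact (h2 x h).elim
    · have h'' : ∀ y, ¬ X.Extends (P.μ w) y := fun y hy => h' ⟨y, hy⟩
      refine Or.inl ?_
      rw [trail, ext_eq_some.2 h, ext_eq_none.2 h'']
      simp only [Option.toList_some, Option.toList_none, List.append_nil, List.singleton_append]
      rw [List.nodup_cons, hmem]
      exact ⟨h1, hn⟩
  · obtain ⟨m, hm⟩ := List.getLast?_eq_some_iff.1 (getLast?_core (X := X) w)
    rw [← h1] at hm
    refine Or.inr ⟨h2, x, m, by rw [trail, ext_eq_some.2 h, ext_eq_none.2 h2, hm]; simp, ?_⟩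
    rw [hm] at hn
    exact (List.perm_append_singleton x m).nodup_iff.1 hn

end Selection

open Selection in
/-- Attaching the edges of the matching to the paths of a path system. -/
theorem PathSystem.nonempty_trailSystem [Finite V] (P : PathSystem G ν k) :
    Nonempty (TrailSystem G k) := by
  obtain ⟨X⟩ := P.nonempty_selection
  refine ⟨{
    μ := P.μ
    F := X.trail
    IsExt := fun w => ∃ x, X.Extends w x
    μ_μ := P.μ_μ
    μ_ne := P.μ_ne
    rev := trail_μ
    length_F := ?_
    shape := ?_
    cover := ?_
    balanced := ?_ }⟩
  · intro w b b' hb hb'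
    have key : ∀ (w : V) (b : Bool), (b = true ↔ ∃ x, X.Extends w x) →
        (X.ext w).toList.length = b.toNat := by
      intro w b hb
      cases b
      · have : X.ext w = none := ext_eq_none.2 fun x hx => by simpa using hb.2 ⟨x, hx⟩
        rw [this]; rfl
      · obtain ⟨x, hx⟩ := hb.1 rfl
        rw [ext_eq_some.2 hx]; rfl
    rw [Selection.trail, List.length_append, List.length_append, key w b hb, key _ b' hb',
      (core_perm w).length_eq, P.length]
    omega
  · intro w
    by_cases h : ∃ x, X.Extends w x
    · obtain ⟨x, hx⟩ := h
      rcases nodup_trail_of_extends hx with h | ⟨h1, h2⟩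
      · exact Or.inl h
      · refine Or.inr ⟨⟨fun _ ⟨y, hy⟩ => h1 y hy, fun _ => ⟨x, hx⟩⟩, h2⟩
    · by_cases h' : ∃ x, X.Extends (P.μ w) x
      · obtain ⟨x, hx⟩ := h'
        rcases nodup_trail_of_extends hx with h1 | ⟨h1, z, m, h2, h3⟩
        · rw [trail_μ, List.nodup_reverse] at h1
          exact Or.inl h1
        · refine Or.inr ⟨⟨fun h4 => (h h4).elim, fun h4 => (h4 ⟨x, hx⟩).elim⟩, z, m.reverse, ?_, ?_⟩
          · rw [trail_μ] at h2
            rw [← List.reverse_reverse (X.trail w), h2]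
            simp
          · simpa using h3
      · refine Or.inl ?_
        rw [Selection.trail, ext_eq_none.2 fun x hx => h ⟨x, hx⟩,
          ext_eq_none.2 fun x hx => h' ⟨x, hx⟩]
        simpa using (core_perm w).nodup_iff.2 (P.nodup w)
  · intro a b hab
    by_cases hb : b = ν a
    · rw [hb]; exact exists_consec_trail_ν a
    · obtain ⟨w, hw⟩ := P.cover a b hab hb
      exact exists_consec_trail_of_T hw
  · intro v
    obtain ⟨φ, hφ, h⟩ := exists_injOn_extends (X := X) v
    have e : {w | (∃ x, X.Extends w x) ∧ (X.trail w).head? = some v} = {w | X.Extends w v} := by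
      ext w
      constructor
      · rintro ⟨⟨x, hx⟩, h1⟩
        rw [head?_trail_of_extends hx, Option.some_inj] at h1
        exact h1 ▸ hx
      · exact fun hx => ⟨⟨v, hx⟩, head?_trail_of_extends hx⟩
    rw [e]
    refine Set.ncard_le_ncard_of_injOn φ (fun w hw => ?_) hφ (Set.toFinite _)
    obtain ⟨h1, h2⟩ := h w hw
    exact ⟨fun ⟨y, hy⟩ => h2 y hy, by rw [head?_trail_of_not h2, h1]⟩

end

/-! ### From trail systems to balanced decompositions -/

section

variable {V : Type*} {G : SimpleGraph V} {k : ℕ}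

theorem length_toSubgraph {u v : V} {p : G.Walk u v} (hp : p.IsTrail) :
    length p.toSubgraph = p.length := by
  classical
  have h : p.toSubgraph.edgeSet = (p.edges.toFinset : Set (Sym2 V)) := by
    ext e
    simp
  rw [length, h, Set.ncard_coe_finset, List.toFinset_card_of_nodup hp.edges_nodup,
    SimpleGraph.Walk.length_edges]

/-- The ends of a path are its vertices of degree one, whatever walk describes it. -/
theorem ncard_neighborSet_of_isPathWithEnd {H : G.Subgraph} {v : V} (h : IsPathWithEnd H v)
    (hH : length H ≠ 0) : v ∈ H.verts ∧ (H.neighborSet v).ncard = 1 := by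
  obtain ⟨w, p, hp, rfl⟩ := h
  rw [length_toSubgraph hp.isTrail] at hH
  refine ⟨p.start_mem_verts_toSubgraph, ?_⟩
  rw [hp.neighborSet_toSubgraph_startpoint (fun h => hH (SimpleGraph.Walk.length_eq_zero_iff.2 h)),
    Set.ncard_singleton]

theorem not_isPathWithEnd_of_isCycle {H : G.Subgraph} (h : IsCycleGraph H) {v : V} :
    ¬ IsPathWithEnd H v := by
  obtain ⟨u, c, hc, rfl⟩ := h
  intro hv
  obtain ⟨h1, h2⟩ := ncard_neighborSet_of_isPathWithEnd hv (by
    rw [length_toSubgraph hc.isTrail]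
    have := hc.three_le_length
    omega)
  rw [hc.ncard_neighborSet_toSubgraph_eq_two (by simpa using h1)] at h2
  omega

theorem eq_or_eq_of_isPathWithEnd {u w v : V} {p : G.Walk u w} (hp : p.IsPath)
    (hl : p.length ≠ 0) (h : IsPathWithEnd p.toSubgraph v) : v = u ∨ v = w := by
  obtain ⟨h1, h2⟩ := ncard_neighborSet_of_isPathWithEnd h (by rwa [length_toSubgraph hp.isTrail])
  rw [SimpleGraph.Walk.mem_verts_toSubgraph,
    SimpleGraph.Walk.mem_support_iff_exists_getVert] at h1
  obtain ⟨i, rfl, hi⟩ := h1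
  rcases Nat.eq_zero_or_pos i with rfl | h0
  · exact Or.inl (SimpleGraph.Walk.getVert_zero p)
  · rcases hi.eq_or_lt with rfl | hi
    · exact Or.inr (SimpleGraph.Walk.getVert_length p)
    · rw [hp.ncard_neighborSet_toSubgraph_internal_eq_two h0.ne' hi] at h2
      omega

variable (G) in
/-- The subgraph of `G` with the vertices of the list `l`, and with the edges of `G` between
consecutive entries of `l`. -/
def listGraph (l : List V) : G.Subgraph where
  verts := {x | x ∈ l}
  Adj a b := G.Adj a b ∧ (Consec l a b ∨ Consec l b a)
  adj_sub h := h.1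
  edge_vert := by
    rintro a b ⟨-, ⟨s, t, rfl⟩ | ⟨s, t, rfl⟩⟩ <;> simp
  symm := ⟨fun a b ⟨h, h'⟩ => ⟨h.symm, h'.symm⟩⟩

theorem listGraph_reverse (l : List V) : listGraph G l.reverse = listGraph G l := by
  ext a b
  · simp [listGraph]
  · simp only [listGraph, consec_reverse]
    tauto

theorem toSubgraph_eq_listGraph {u v : V} (p : G.Walk u v) :
    p.toSubgraph = listGraph G p.support := by
  have h : ∀ a b, [a, b] <:+: p.support ↔ Consec p.support a b := by
    intro a b
    constructor
    · rintro ⟨s, t, h⟩; exact ⟨s, t, by rw [← h]; simp⟩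
    · rintro ⟨s, t, h⟩; exact ⟨s, t, by rw [h]; simp⟩
  ext a b
  · simp [listGraph]
  · rw [SimpleGraph.Walk.adj_toSubgraph_iff_mem_edges,
      ← SimpleGraph.Walk.infix_support_iff_mem_edges, h, h]
    refine ⟨fun hab => ⟨?_, hab⟩, fun hab => hab.2⟩
    rw [← h, ← h, SimpleGraph.Walk.infix_support_iff_mem_edges] at hab
    exact p.adj_of_mem_edges hab

theorem isPath_listGraph {l : List V} (hc : l.IsChain G.Adj) (hn : l.Nodup) {a z : V}
    (ha : l.head? = some a) (hz : l.getLast? = some z) :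
    ∃ p : G.Walk a z, p.IsPath ∧ p.toSubgraph = listGraph G l ∧ p.length + 1 = l.length := by
  obtain ⟨p, rfl⟩ := exists_walk_of_isChain hc ha hz
  exact ⟨p, SimpleGraph.Walk.IsPath.mk' hn, toSubgraph_eq_listGraph p, by simp⟩

theorem isCycle_listGraph {z : V} {m : List V} (hc : (z :: m ++ [z]).IsChain G.Adj)
    (hn : (z :: m).Nodup) (hm : 2 ≤ m.length) :
    ∃ p : G.Walk z z, p.IsCycle ∧ p.toSubgraph = listGraph G (z :: m ++ [z]) ∧
      p.length = m.length + 1 := by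
  obtain ⟨p, hp⟩ := exists_walk_of_isChain hc rfl List.getLast?_concat
  have hl : p.length = m.length + 1 := by
    have := p.length_support
    rw [hp] at this
    simpa using this.symm
  refine ⟨p, ?_, by rw [toSubgraph_eq_listGraph, hp], hl⟩
  cases p with
  | nil => simp at hl
  | cons h q =>
    simp only [SimpleGraph.Walk.length_cons] at hl
    have hq : q.support = m ++ [z] := by simpa using hp
    have hqp : q.IsPath := by
      rw [SimpleGraph.Walk.isPath_def, hq]
      exact (List.perm_append_singleton z m).nodup_iff.2 hn
    rw [SimpleGraph.Walk.cons_isCycle_iff]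
    refine ⟨hqp, fun he => ?_⟩
    rw [Sym2.eq_swap] at he
    have := hqp.length_eq_one_of_mem_edges he
    omega

theorem ncard_setOf [Fintype V] (p : V → Prop) [DecidablePred p] :
    {w | p w}.ncard = (Finset.univ.filter p).card := by
  rw [← Set.ncard_coe_finset]
  congr 1
  ext
  simp

theorem ncard_le_of_fiberwise [Finite V] {ι : Type*} [Fintype ι] {p q : V → Prop} (h : V → ι)
    (hle : ∀ i, {w | p w ∧ h w = i}.ncard ≤ {w | q w ∧ h w = i}.ncard) :
    {w | p w}.ncard ≤ {w | q w}.ncard := by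
  classical
  have := Fintype.ofFinite V
  have key : ∀ p : V → Prop, {w | p w}.ncard = ∑ i, {w | p w ∧ h w = i}.ncard := by
    intro p
    rw [ncard_setOf, Finset.card_eq_sum_card_fiberwise (f := h) (t := Finset.univ) (by simp)]
    refine Finset.sum_congr rfl fun i _ => ?_
    rw [Finset.filter_filter, ncard_setOf]
  rw [key p, key q]
  exact Finset.sum_le_sum fun i _ => hle i

/-- A map whose fibers are the orbits of the involution `μ` is two-to-one. -/
theorem two_mul_ncard_image {W : Type*} [Finite V] {μ : V → V} (hμ : ∀ x, μ x ≠ x) {f : V → W}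
    (hf : ∀ x y, f x = f y ↔ y = x ∨ y = μ x) (E : Set V) (hE : ∀ x ∈ E, μ x ∈ E) :
    E.ncard = 2 * (f '' E).ncard := by
  classical
  have := Fintype.ofFinite V
  have e1 : E.ncard = E.toFinset.card := by rw [Set.ncard_eq_toFinset_card']
  have e2 : (f '' E).ncard = (E.toFinset.image f).card := by
    rw [← Set.ncard_coe_finset]; simp
  rw [e1, e2, Finset.card_eq_sum_card_image f, mul_comm]
  refine Finset.sum_eq_card_nsmul fun b hb => ?_
  obtain ⟨x, hx, rfl⟩ := Finset.mem_image.1 hb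
  have : E.toFinset.filter (fun a => f a = f x) = {x, μ x} := by
    ext y
    simp only [Set.mem_toFinset] at hx
    simp only [Finset.mem_filter, Set.mem_toFinset, Finset.mem_insert, Finset.mem_singleton]
    rw [eq_comm, hf]
    constructor
    · exact fun h => h.2
    · rintro (rfl | rfl)
      · exact ⟨hx, Or.inl rfl⟩
      · exact ⟨hE _ hx, Or.inr rfl⟩
  rw [this, Finset.card_pair (hμ x).symm]

namespace TrailSystem

variable (Y : TrailSystem G k)

theorem length_mem (w : V) : 2 * k ≤ (Y.F w).length ∧ (Y.F w).length ≤ 2 * k + 2 := by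
  classical
  have := Y.length_F w (decide (Y.IsExt w)) (decide (Y.IsExt (Y.μ w))) (by simp) (by simp)
  have h1 := (decide (Y.IsExt w)).toNat_le
  have h2 := (decide (Y.IsExt (Y.μ w))).toNat_le
  omega

variable {Y}

theorem length_eq_iff {w : V} : ((Y.F w).length = 2 * k ↔ ¬ Y.IsExt w ∧ ¬ Y.IsExt (Y.μ w)) ∧
    ((Y.F w).length = 2 * k + 2 ↔ Y.IsExt w ∧ Y.IsExt (Y.μ w)) := by
  by_cases h : Y.IsExt w <;> by_cases h' : Y.IsExt (Y.μ w)
  · have := Y.length_F w true true (by simp [h]) (by simp [h'])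
    simp only [this, h, h', Bool.toNat_true]
    simp
    omega
  · have := Y.length_F w true false (by simp [h]) (by simp [h'])
    simp [this, h, h']
  · have := Y.length_F w false true (by simp [h]) (by simp [h'])
    simp [this, h, h']
  · have := Y.length_F w false false (by simp [h]) (by simp [h'])
    simp [this, h, h']

theorem exists_head? (hk : 3 ≤ k) (w : V) : ∃ v, (Y.F w).head? = some v := by
  have := (Y.length_mem w).1
  rcases h : Y.F w with _ | ⟨v, t⟩
  · rw [h] at this; simp at this; omega
  · exact ⟨v, rfl⟩

theorem ncard_isExt_le [Fintype V] (hk : 3 ≤ k) :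
    {w | Y.IsExt w}.ncard ≤ {w | ¬ Y.IsExt w}.ncard := by
  refine ncard_le_of_fiberwise (fun w => (exists_head? (Y := Y) hk w).choose) fun v => ?_
  have h : ∀ w, (exists_head? (Y := Y) hk w).choose = v ↔ (Y.F w).head? = some v := fun w => by
    have hs := (exists_head? (Y := Y) hk w).choose_spec
    exact ⟨fun e => e ▸ hs, fun e => Option.some.inj (hs.symm.trans e)⟩
  simp only [h]
  exact Y.balanced v

/-- A trail system has enough trails to cover all edges, and by `ncard_isExt_le` not more positions
than there are darts; so its trails are edge-disjoint, and exactly half of the ends are extended. -/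
theorem counting [Fintype V] (hk : 3 ≤ k) (hdeg : ∀ v, {w | G.Adj v w}.ncard = 2 * k) :
    (∀ u a b, Consec (Y.F u) a b → G.Adj a b) ∧
      (∀ u w a b, Consec (Y.F u) a b → Consec (Y.F w) a b → u = w) ∧
      {w | Y.IsExt w}.ncard = {w | ¬ Y.IsExt w}.ncard := by
  classical
  have hle := ncard_isExt_le (Y := Y) hk
  have hD := card_filter_pairs G.Adj (2 * k) hdeg
  have e1 : {w | Y.IsExt w}.ncard = ∑ w, (decide (Y.IsExt w)).toNat := by
    rw [ncard_setOf, Finset.card_filter]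
    exact Finset.sum_congr rfl fun w _ => by by_cases h : Y.IsExt w <;> simp [h]
  have e2 : ∑ w, (decide (Y.IsExt (Y.μ w))).toNat = ∑ w, (decide (Y.IsExt w)).toNat :=
    Equiv.sum_comp (Function.Involutive.toPerm Y.μ Y.μ_μ) (fun w => (decide (Y.IsExt w)).toNat)
  have e3 : {w | Y.IsExt w}.ncard + {w | ¬ Y.IsExt w}.ncard = Fintype.card V := by
    rw [← Nat.card_eq_fintype_card]
    exact Set.ncard_add_ncard_compl {w | Y.IsExt w}
  have hsum : ∑ w, ((Y.F w).length - 1) =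
      Fintype.card V * (2 * k - 1) + 2 * {w | Y.IsExt w}.ncard := by
    have : ∀ w, (Y.F w).length - 1 = (2 * k - 1) + (decide (Y.IsExt w)).toNat +
        (decide (Y.IsExt (Y.μ w))).toNat := fun w => by
      have := Y.length_F w (decide (Y.IsExt w)) (decide (Y.IsExt (Y.μ w))) (by simp) (by simp)
      omega
    simp only [this, Finset.sum_add_distrib, e2, ← e1]
    simp
    ring
  obtain ⟨j, rfl⟩ : ∃ j, k = j + 1 := ⟨k - 1, by omega⟩
  have hj : 2 * (j + 1) - 1 = 2 * j + 1 := by omega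
  rw [hj] at hsum
  obtain ⟨h1, h2, h3⟩ := consec_unique Y.F (Finset.univ.filter fun p : V × V => G.Adj p.1 p.2)
    (fun d hd => Y.cover _ _ (by simpa using hd)) (by rw [hD, hsum]; nlinarith)
  refine ⟨fun u a b h => by simpa using h1 u a b h, h2, ?_⟩
  rw [hD, hsum] at h3
  nlinarith

theorem nodup_or (w : V) : (Y.F w).Nodup ∨ (¬ (Y.F w).Nodup ∧ (Y.F w).length = 2 * k + 1 ∧
    (Y.IsExt w ↔ ¬ Y.IsExt (Y.μ w)) ∧ ∃ z m, Y.F w = z :: m ++ [z] ∧ (z :: m).Nodup) := by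
  by_cases hn : (Y.F w).Nodup
  · exact Or.inl hn
  · obtain ⟨h1, h2⟩ := (Y.shape w).resolve_left hn
    refine Or.inr ⟨hn, ?_, h1, h2⟩
    have h3 := Y.length_mem w
    have h4 := length_eq_iff (Y := Y) (w := w)
    have h5 : (Y.F w).length ≠ 2 * k := fun h => by have := h4.1.1 h; tauto
    have h6 : (Y.F w).length ≠ 2 * k + 2 := fun h => by have := h4.2.1 h; tauto
    omega

/-- The counts of ends in `TrailSystem.balanced`, restricted to the trails that are paths: a closed
trail contributes one to each side. -/
theorem balanced_nodup [Finite V] (v : V) :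
    {w | (Y.F w).Nodup ∧ Y.IsExt w ∧ (Y.F w).head? = some v}.ncard ≤
      {w | (Y.F w).Nodup ∧ ¬ Y.IsExt w ∧ (Y.F w).head? = some v}.ncard := by
  have hsplit : ∀ p : V → Prop, {w | p w ∧ (Y.F w).head? = some v}.ncard =
      {w | (Y.F w).Nodup ∧ p w ∧ (Y.F w).head? = some v}.ncard +
      {w | ¬ (Y.F w).Nodup ∧ p w ∧ (Y.F w).head? = some v}.ncard := by
    intro p
    rw [← Set.ncard_union_eq]
    · congr 1
      ext w
      simp only [Set.mem_ofPred_eq, Set.mem_union]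
      tauto
    · exact Set.disjoint_left.2 fun w h1 h2 => h2.1 h1.1
  have h1 : {w | ¬ (Y.F w).Nodup ∧ ¬ Y.IsExt w ∧ (Y.F w).head? = some v}.ncard ≤
      {w | ¬ (Y.F w).Nodup ∧ Y.IsExt w ∧ (Y.F w).head? = some v}.ncard := by
    refine Set.ncard_le_ncard_of_injOn Y.μ ?_ ?_ (Set.toFinite _)
    · rintro w ⟨hn, he, hv⟩
      obtain ⟨-, -, hs, z, m, hz, -⟩ := (nodup_or w).resolve_left hn
      refine ⟨by rwa [Y.rev, List.nodup_reverse], by tauto, ?_⟩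
      rw [Y.rev, hz]
      rw [hz] at hv
      simpa using hv
    · intro a _ b _ hab
      rw [← Y.μ_μ a, hab, Y.μ_μ]
  have h2 := Y.balanced v
  rw [hsplit, hsplit] at h2
  omega

/-- The trail with end `w`, as a subgraph. -/
def graph (Y : TrailSystem G k) (w : V) : G.Subgraph := listGraph G (Y.F w)

theorem graph_μ (w : V) : Y.graph (Y.μ w) = Y.graph w := by
  rw [graph, Y.rev, listGraph_reverse, graph]

theorem getLast?_eq (w : V) : (Y.F w).getLast? = (Y.F (Y.μ w)).head? := by
  rw [Y.rev, List.head?_reverse]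

theorem exists_isPath (hk : 3 ≤ k) (hadj : ∀ u a b, Consec (Y.F u) a b → G.Adj a b) {w : V}
    (hn : (Y.F w).Nodup) : ∃ a z, (Y.F w).head? = some a ∧ (Y.F (Y.μ w)).head? = some z ∧
      a ≠ z ∧ ∃ p : G.Walk a z, p.IsPath ∧ p.toSubgraph = Y.graph w ∧
        p.length + 1 = (Y.F w).length := by
  obtain ⟨a, ha⟩ := exists_head? (Y := Y) hk w
  obtain ⟨z, hz⟩ := exists_head? (Y := Y) hk (Y.μ w)
  obtain ⟨p, h1, h2, h3⟩ := isPath_listGraph (isChain_iff_consec.2 (hadj w)) hn ha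
    ((getLast?_eq w).trans hz)
  refine ⟨a, z, ha, hz, ?_, p, h1, h2, h3⟩
  rintro rfl
  have := (Y.length_mem w).1
  rw [SimpleGraph.Walk.isPath_iff_nil.1 h1 |> SimpleGraph.Walk.length_eq_zero_iff.2] at h3
  omega

theorem isCycleGraph_graph (hk : 3 ≤ k) (hadj : ∀ u a b, Consec (Y.F u) a b → G.Adj a b) {w : V}
    (hn : ¬ (Y.F w).Nodup) : IsCycleGraph (Y.graph w) ∧ length (Y.graph w) = 2 * k := by
  obtain ⟨-, hl, -, z, m, hm, hn'⟩ := (nodup_or w).resolve_left hn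
  have hc := isChain_iff_consec.2 (hadj w)
  rw [hm] at hl hc
  simp at hl
  obtain ⟨p, h1, h2, h3⟩ := isCycle_listGraph hc hn' (by omega)
  rw [← hm] at h2
  refine ⟨⟨z, p, h1, h2⟩, ?_⟩
  rw [graph, ← h2, length_toSubgraph h1.isTrail]
  omega

theorem length_graph (hk : 3 ≤ k) (hadj : ∀ u a b, Consec (Y.F u) a b → G.Adj a b) (w : V) :
    length (Y.graph w) + 1 = (Y.F w).length := by
  rcases nodup_or (Y := Y) w with hn | ⟨hn, hl, -⟩
  · obtain ⟨a, z, -, -, -, p, h1, h2, h3⟩ := exists_isPath hk hadj hn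
    rw [← h2, length_toSubgraph h1.isTrail, h3]
  · rw [(isCycleGraph_graph hk hadj hn).2, hl]

theorem nodup_of_isPathWithEnd (hk : 3 ≤ k) (hadj : ∀ u a b, Consec (Y.F u) a b → G.Adj a b)
    {w v : V} (h : IsPathWithEnd (Y.graph w) v) : (Y.F w).Nodup := by
  by_contra hn
  exact not_isPathWithEnd_of_isCycle (isCycleGraph_graph hk hadj hn).1 h

theorem head?_of_isPathWithEnd (hk : 3 ≤ k) (hadj : ∀ u a b, Consec (Y.F u) a b → G.Adj a b)
    {w v : V} (h : IsPathWithEnd (Y.graph w) v) :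
    (Y.F w).head? = some v ∨ (Y.F (Y.μ w)).head? = some v := by
  obtain ⟨a, z, ha, hz, -, p, h1, h2, h3⟩ :=
    exists_isPath hk hadj (nodup_of_isPathWithEnd hk hadj h)
  have := (Y.length_mem w).1
  rw [← h2] at h
  rcases eq_or_eq_of_isPathWithEnd h1 (by omega) h with rfl | rfl
  · exact Or.inl ha
  · exact Or.inr hz

/-- The trails of a trail system form a balanced decomposition. -/
theorem isBalancedDecomposition [Fintype V] (Y : TrailSystem G k) (hk : 3 ≤ k)
    (hdeg : ∀ v, {w | G.Adj v w}.ncard = 2 * k) :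
    IsBalancedDecomposition k (Set.range Y.graph) ∧
      ∀ H ∈ Set.range Y.graph, IsCycleGraph H → length H = 2 * k := by
  obtain ⟨hadj, huniq, hcount⟩ := counting (Y := Y) hk hdeg
  have hlen := length_graph (Y := Y) hk hadj
  have hshort : ∀ w, length (Y.graph w) = 2 * k - 1 ↔ ¬ Y.IsExt w ∧ ¬ Y.IsExt (Y.μ w) := by
    intro w
    have := hlen w
    rw [← (length_eq_iff (Y := Y)).1]
    omega
  have hlong : ∀ w, length (Y.graph w) = 2 * k + 1 ↔ Y.IsExt w ∧ Y.IsExt (Y.μ w) := by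
    intro w
    have := hlen w
    rw [← (length_eq_iff (Y := Y)).2]
    omega
  have hrange : ∀ w, 2 * k - 1 ≤ length (Y.graph w) ∧ length (Y.graph w) ≤ 2 * k + 1 := by
    intro w
    have := hlen w
    have := Y.length_mem w
    omega
  -- a common edge determines a trail up to its direction
  have hedge : ∀ w u a b, (Y.graph w).Adj a b → (Y.graph u).Adj a b → u = w ∨ u = Y.μ w := by
    have key : ∀ w u a b, Consec (Y.F w) a b → (Y.graph u).Adj a b → u = w ∨ u = Y.μ w := by
      rintro w u a b h1 ⟨-, h2 | h2⟩
      · exact Or.inl (huniq _ _ _ _ h2 h1)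
      · rw [← consec_reverse, ← Y.rev] at h2
        exact Or.inr (by rw [← huniq _ _ _ _ h2 h1, Y.μ_μ])
    rintro w u a b ⟨-, h1 | h1⟩ h2
    · exact key w u a b h1 h2
    · exact key w u b a h1 h2.symm
  have hnonempty : ∀ w, (Y.graph w).edgeSet.Nonempty := by
    intro w
    by_contra h
    rw [Set.not_nonempty_iff_eq_empty] at h
    have h1 := (hrange w).1
    rw [length, h, Set.ncard_empty] at h1
    omega
  have hgraph : ∀ w u, Y.graph w = Y.graph u ↔ u = w ∨ u = Y.μ w := by
    intro w u
    constructor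
    · intro h
      obtain ⟨e, he⟩ := hnonempty w
      induction e with
      | _ a b => exact hedge w u a b he (h ▸ he)
    · rintro (rfl | rfl)
      · rfl
      · exact (graph_μ _).symm
  have hpc : ∀ w, IsPathGraph (Y.graph w) ∨ IsCycleGraph (Y.graph w) := by
    intro w
    by_cases hn : (Y.F w).Nodup
    · obtain ⟨a, z, -, -, -, p, h1, h2, h3⟩ := exists_isPath hk hadj hn
      exact Or.inl ⟨a, z, p, h1, h2⟩
    · exact Or.inr (isCycleGraph_graph hk hadj hn).1
  have hcyc : ∀ w, IsCycleGraph (Y.graph w) → length (Y.graph w) = 2 * k := by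
    intro w h
    refine (isCycleGraph_graph hk hadj fun hn => ?_).2
    obtain ⟨a, z, -, -, -, p, h1, h2, h3⟩ := exists_isPath hk hadj hn
    exact not_isPathWithEnd_of_isCycle h ⟨z, p, h1, h2⟩
  refine ⟨⟨⟨⟨?_, ?_, ?_⟩, ?_, ?_⟩, ?_, ?_⟩, ?_⟩
  · rintro _ ⟨w, rfl⟩
    exact hnonempty w
  · rintro _ ⟨w, rfl⟩ _ ⟨u, rfl⟩ hne
    rw [Function.onFun, Set.disjoint_left]
    intro e he he'
    induction e with
    | _ a b => exact hne ((hgraph w u).2 (hedge w u a b he he'))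
  · ext e
    simp only [Set.mem_iUnion, Set.mem_range, exists_prop, exists_exists_eq_and]
    constructor
    · rintro ⟨w, he⟩
      exact (Y.graph w).edgeSet_subset he
    · intro he
      induction e with
      | _ a b =>
        obtain ⟨w, hw⟩ := Y.cover a b he
        exact ⟨w, he, Or.inl hw⟩
  · rintro _ ⟨w, rfl⟩
    exact hpc w
  · rintro _ ⟨w, rfl⟩
    have := hrange w
    simp only [Set.mem_insert_iff, Set.mem_singleton_iff]
    omega
  · intro v
    have h1 : {H ∈ Set.range Y.graph | IsPathWithEnd H v ∧ 2 * k + 1 ≤ length H} ⊆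
        Y.graph '' {w | (Y.F w).Nodup ∧ Y.IsExt w ∧ (Y.F w).head? = some v} := by
      rintro _ ⟨⟨w, rfl⟩, h1, h2⟩
      have hn := nodup_of_isPathWithEnd hk hadj h1
      have he := (hlong w).1 (le_antisymm (hrange w).2 h2)
      rcases head?_of_isPathWithEnd hk hadj h1 with h3 | h3
      · exact ⟨w, ⟨hn, he.1, h3⟩, rfl⟩
      · exact ⟨Y.μ w, ⟨by rwa [Y.rev, List.nodup_reverse], he.2, h3⟩, graph_μ w⟩
    refine (Set.ncard_le_ncard h1 (Set.toFinite _)).trans ((Set.ncard_image_le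
      (Set.toFinite _)).trans ((balanced_nodup v).trans ?_))
    refine Set.ncard_le_ncard_of_injOn Y.graph ?_ ?_
      ((Set.finite_range Y.graph).subset (Set.sep_subset _ _))
    · rintro w ⟨hn, he, hv⟩
      refine ⟨⟨w, rfl⟩, ?_, ?_⟩
      · obtain ⟨a, z, ha, -, -, p, hp, hpg, -⟩ := exists_isPath hk hadj hn
        obtain rfl : a = v := by rw [hv] at ha; exact (Option.some.inj ha).symm
        exact ⟨z, p, hp, hpg⟩
      · have h3 := (hrange w).2
        have h4 : length (Y.graph w) ≠ 2 * k + 1 := fun h => he ((hlong w).1 h).1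
        omega
    · rintro w ⟨hn, he, hv⟩ u ⟨-, -, hu⟩ h
      rcases (hgraph w u).1 h with rfl | rfl
      · rfl
      · obtain ⟨a, z, ha, hz, hne, -⟩ := exists_isPath hk hadj hn
        rw [hv] at ha
        rw [hu] at hz
        exact (hne ((Option.some.inj ha).symm.trans (Option.some.inj hz))).elim
  · have h1 : {H ∈ Set.range Y.graph | IsPathGraph H ∧ length H = 2 * k - 1} =
        Y.graph '' {w | ¬ Y.IsExt w ∧ ¬ Y.IsExt (Y.μ w)} := by
      ext H
      constructor
      · rintro ⟨⟨w, rfl⟩, -, h⟩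
        exact ⟨w, (hshort w).1 h, rfl⟩
      · rintro ⟨w, hw, rfl⟩
        have hl := (hshort w).2 hw
        refine ⟨⟨w, rfl⟩, (hpc w).resolve_right fun hc => ?_, hl⟩
        rw [hcyc w hc] at hl
        omega
    have h2 : {H ∈ Set.range Y.graph | IsPathGraph H ∧ length H = 2 * k + 1} =
        Y.graph '' {w | Y.IsExt w ∧ Y.IsExt (Y.μ w)} := by
      ext H
      constructor
      · rintro ⟨⟨w, rfl⟩, -, h⟩
        exact ⟨w, (hlong w).1 h, rfl⟩
      · rintro ⟨w, hw, rfl⟩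
        have hl := (hlong w).2 hw
        refine ⟨⟨w, rfl⟩, (hpc w).resolve_right fun hc => ?_, hl⟩
        rw [hcyc w hc] at hl
        omega
    have h3 := two_mul_ncard_image Y.μ_ne hgraph {w | ¬ Y.IsExt w ∧ ¬ Y.IsExt (Y.μ w)}
      (fun w hw => ⟨hw.2, by rw [Y.μ_μ]; exact hw.1⟩)
    have h4 := two_mul_ncard_image Y.μ_ne hgraph {w | Y.IsExt w ∧ Y.IsExt (Y.μ w)}
      (fun w hw => ⟨hw.2, by rw [Y.μ_μ]; exact hw.1⟩)
    have hsplit : ∀ p q : V → Prop, {w | p w}.ncard =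
        {w | p w ∧ q w}.ncard + {w | p w ∧ ¬ q w}.ncard := by
      intro p q
      rw [← Set.ncard_union_eq]
      · congr 1
        ext w
        simp only [Set.mem_ofPred_eq, Set.mem_union]
        tauto
      · exact Set.disjoint_left.2 fun w h1 h2 => h2.2 h1.2
    have h5 : {w | Y.IsExt w ∧ ¬ Y.IsExt (Y.μ w)}.ncard =
        {w | ¬ Y.IsExt w ∧ Y.IsExt (Y.μ w)}.ncard := by
      refine Set.ncard_congr (fun w _ => Y.μ w) (fun w hw => ⟨hw.2, by rw [Y.μ_μ]; exact hw.1⟩)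
        (fun a b _ _ hab => by rw [← Y.μ_μ a, hab, Y.μ_μ])
        (fun b hb => ⟨Y.μ b, ⟨hb.2, ?_⟩, Y.μ_μ b⟩)
      rw [Y.μ_μ]; exact hb.1
    rw [hsplit _ (fun w => Y.IsExt (Y.μ w)), hsplit (fun w => ¬ Y.IsExt w)
      (fun w => Y.IsExt (Y.μ w))] at hcount
    rw [h1, h2]
    omega
  · rintro _ ⟨w, rfl⟩ h
    exact hcyc w h

end TrailSystem

end

end PathCycleDecomposition

theorem theorem3 {V : Type*} [Fintype V] (k : ℕ) (hk : 3 ≤ k) (G : SimpleGraph V)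
    [G.LocallyFinite] (hG : PathCycleDecomposition.InClass k G) :
    ∃ D : Set G.Subgraph, PathCycleDecomposition.IsBalancedDecomposition k D ∧
      ∀ H ∈ D, PathCycleDecomposition.IsCycleGraph H →
        PathCycleDecomposition.length H = 2 * k := by
  obtain ⟨M, N, hM, hN, hdisj⟩ := hG.matchings
  rw [SimpleGraph.Subgraph.isPerfectMatching_iff] at hM hN
  choose m hm hm' using hM
  choose ν hν hν' using hN
  have hdeg : ∀ v, {w | G.Adj v w}.ncard = 2 * k := fun v => by
    rw [← hG.regular v, ← SimpleGraph.card_neighborSet_eq_degree, ← Nat.card_eq_fintype_card]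
    rfl
  obtain ⟨P⟩ := PathCycleDecomposition.nonempty_pathSystem (m := m) (ν := ν) hk hG.girth hdeg
    (fun v => (hν v).adj_sub) (fun v => (hν' _ _ (hν v).symm).symm)
    (fun v => (hm v).adj_sub) (fun v => (hm' _ _ (hm v).symm).symm)
    (fun v h => Set.disjoint_left.1 hdisj (show s(v, m v) ∈ M.edgeSet from hm v)
      (show N.Adj v (m v) by rw [h]; exact hν v))
  obtain ⟨Y⟩ := P.nonempty_trailSystem
  exact ⟨_, Y.isBalancedDecomposition hk hdeg⟩
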